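/- **Setting.** Types are built from a finite set of base types and a type $o$ of propositions by $\to$. A type is *first-order* if it does not contain $o$, and *propositional* if it has the form $\tau_1\to\dots\to\tau_n\to o$ ($n\ge 0$) with all $\tau_i$ first-order. Fix a signature of typed non-logical constants, each of first-order or propositional type; those of propositional type are the predicate constants. There are also countably many nominal constants in each type, and the logical constants $\bot,\top:o$, $\wedge,\vee,\supset:o\to o\to o$ and $\forall_\alpha,\exists_\alpha,\nabla_\alpha:(\alpha\to o)\to o$ for $\alpha$ first-order. Terms are simply typed $\lambda$-terms over these constants modulo $\alpha\beta\eta$; formulas are terms of type $o$; ground terms are closed terms (they may contain nominals), and $\mathrm{ground}(\alpha)$ is the set of those of type $\alpha$. Atoms are the formulas $p\,\vec t$ with $p$ a predicate constant. The support $\mathrm{supp}(t)$ is the set of nominals of (the normal form of) $t$. A *valid* set of definitions $\mathcal D$ is a set of clauses $H\stackrel{\Delta}{=}_{\mathcal X}B$, where $H=p\,\vec t$ is an atom in the $L_\lambda$ pattern fragment in which every variable of $\mathcal X$ occurs, and $B$ is a formula over $\mathcal X$, both with empty support. A *valid* set of inductive definitions $\mathcal I$ is a set of clauses $p\,\vec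 x\stackrel{\mu}{=}B\,p\,\vec x$ with $p:\omega$ a predicate constant and $B:\omega\to\omega$ a closed term with empty support not containing $p$; each $p$ heads at most one clause of $\mathcal I$, and then no clause of $\mathcal D$. Given an assignment of an ordinal $\mathrm{lvl}(A)$ to each ground atom $A$, put $\mathrm{lvl}(\bot)=\mathrm{lvl}(\top)=0$, $\mathrm{lvl}(A\wedge B)=\mathrm{lvl}(A\vee B)=\max(\mathrm{lvl}A,\mathrm{lvl}B)$, $\mathrm{lvl}(A\supset B)=\max(\mathrm{lvl}A+1,\mathrm{lvl}B)$, $\mathrm{lvl}(\forall_\alpha x.C)=\mathrm{lvl}(\exists_\alpha x.C)=\sup_{t\in\mathrm{ground}(\alpha)}\mathrm{lvl}(C[t/x])$, and $\mathrm{lvl}(\nabla_\alpha x.C)=\mathrm{lvl}(C[n/x])$ for $n\notin\mathrm{supp}(C)$ (when this does not depend on $n$). $\mathcal D$ is *weakly stratified* if $\mathrm{lvl}(B\rho)$ is defined and $\mathrm{lvl}(B\rho)\le\mathrm{lvl}(H\rho)$ for each of its clauses and each grounding substitution $\rho$. $\mathcal I$ is *strictly stratified* if $\mathrm{lvl}(B\,p\,\vec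 t)$ is defined, $\mathrm{lvl}(B\,p\,\vec t)\le\mathrm{lvl}(p\,\vec t)$, and $\mathrm{lvl}(p\,\vec t)=\mathrm{lvl}(p\,\vec u)$ for each of its clauses and all ground $\vec t,\vec u$. **The logic $\mathrm{LD}^{\mu\nabla}_\infty(\mathcal D,\mathcal I)$** derives ground sequents $\Gamma\vdash C$ ($\Gamma$ a finite multiset of ground formulas, $C$ a ground formula) inductively by: * the usual intuitionistic left and right rules for $\bot,\top,\wedge,\vee,\supset$; contraction and weakening on the left; * axiom: $A\vdash A[\pi]$ for $A$ atomic and $\pi$ a type-preserving permutation of the nominals; * multicut ($n\ge 0$): from $\Delta_i\vdash A_i$ ($1\le i\le n$) and $\Gamma,A_1,\dots,A_n\vdash C$ infer $\Gamma,\Delta_1,\dots,\Delta_n\vdash C$; * $\forall\mathcal L$, $\exists\mathcal R$: with an arbitrary instance $t\in\mathrm{ground}(\alpha)$; $\forall\mathcal R$, $\exists\mathcal L$: with one premise for every $t\in\mathrm{ground}(\alpha)$; * $\nabla\mathcal L$, $\nabla\mathcal R$: replace $\nabla_\alpha x.C$ by $C[n/x]$ for some nominal $n:\alpha$, $n\notin\mathrm{supp}(C)$;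 * $\Delta\mathcal R$: from $\Gamma\vdash B\rho$ infer $\Gamma\vdash H\rho$, for a clause $H\stackrel{\Delta}{=}_{\mathcal X}B$ of $\mathcal D$ and $\rho$ grounding; $\Delta\mathcal L$: infer $\Gamma,A\vdash C$, for an atom $A$ whose predicate is not the head of a clause of $\mathcal I$, from the premises $\Gamma,B\rho\vdash C$ for all clauses of $\mathcal D$ and grounding $\rho$ with $H\rho=A$; * for a clause $p\,\vec x\stackrel{\mu}{=}B\,p\,\vec x$ of $\mathcal I$ with $p:\omega$: $\mu\mathcal R$: from $\Gamma\vdash B\,p\,\vec t$ infer $\Gamma\vdash p\,\vec t$; $\mu\mathcal L$: for any closed term $S:\omega$, from $B\,S\,\vec t\vdash S\,\vec t$ for all ground $\vec t$, and $\Gamma,S\,\vec u\vdash C$, infer $\Gamma,p\,\vec u\vdash C$. **Corollary (Consistency of $\mathrm{LD}^{\mu\nabla}_\infty$).** Let $\mathcal D$ be a valid set of definitions and $\mathcal I$ a valid set of inductive definitions and suppose that, for one assignment of levels to ground atoms, $\mathcal D$ is weakly stratified and $\mathcal I$ is strictly stratified. Then $\mathrm{LD}^{\mu\nabla}_\infty(\mathcal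 D,\mathcal I)$ is consistent: the sequent $\vdash\bot$ is not derivable. -/

import Mathlib

universe u

namespace LD

/-! ## Types, signatures and terms -/

/-- Simple types over a set of base types, with the type `o` of propositions. -/
inductive Ty (Base : Type u) : Type u
  | base (b : Base) : Ty Base
  | o : Ty Base
  | arr (a b : Ty Base) : Ty Base

variable {Base : Type u}

/-- A type is first-order if `o` does not occur in it. -/
def Ty.FirstOrder : Ty Base → Prop
  | .base _ => True
  | .o => False
  | .arr a b => a.FirstOrder ∧ b.FirstOrder

/-- A type is propositional if it is `τ₁ → ⋯ → τₙ → o` with all `τᵢ` first-order. -/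
def Ty.Propositional : Ty Base → Prop
  | .base _ => False
  | .o => True
  | .arr a b => a.FirstOrder ∧ b.Propositional

/-- The non-logical constants of each type. Function symbols have first-order types and
predicate symbols have propositional types. -/
structure Signature (Base : Type u) where
  Con : Ty Base → Type u
  typed : ∀ τ, Nonempty (Con τ) → τ.FirstOrder ∨ τ.Propositional

/-- The logical constants; quantification is over first-order types. -/
inductive LogCon : Ty Base → Type u
  | bot : LogCon .o
  | top : LogCon .o
  | and : LogCon (.arr .o (.arr .o .o))
  | or : LogCon (.arr .o (.arr .o .o))
  | imp : LogCon (.arr .o (.arr .o .o))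
  | all (a : Ty Base) (h : a.FirstOrder) : LogCon (.arr (.arr a .o) .o)
  | ex (a : Ty Base) (h : a.FirstOrder) : LogCon (.arr (.arr a .o) .o)
  | nab (a : Ty Base) (h : a.FirstOrder) : LogCon (.arr (.arr a .o) .o)

/-- Typed de Bruijn variables of a variable context. -/
inductive Var : List (Ty Base) → Ty Base → Type u
  | zero {Γ : List (Ty Base)} {τ : Ty Base} : Var (τ :: Γ) τ
  | succ {Γ : List (Ty Base)} {σ τ : Ty Base} (x : Var Γ τ) : Var (σ :: Γ) τ

/-- The de Bruijn index of a variable. -/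
def Var.idx : {Γ : List (Ty Base)} → {τ : Ty Base} → Var Γ τ → ℕ
  | _, _, .zero => 0
  | _, _, .succ x => x.idx + 1

/-- Well-typed (raw) lambda terms over a variable context. `nom τ k` is the `k`-th nominal
constant of type `τ`. -/
inductive Tm (S : Signature Base) : List (Ty Base) → Ty Base → Type u
  | var {Γ : List (Ty Base)} {τ : Ty Base} (x : Var Γ τ) : Tm S Γ τ
  | con {Γ : List (Ty Base)} {τ : Ty Base} (c : S.Con τ) : Tm S Γ τ
  | log {Γ : List (Ty Base)} {τ : Ty Base} (c : LogCon τ) : Tm S Γ τ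
  | nom {Γ : List (Ty Base)} (τ : Ty Base) (k : ℕ) : Tm S Γ τ
  | app {Γ : List (Ty Base)} {a b : Ty Base} (f : Tm S Γ (.arr a b)) (t : Tm S Γ a) : Tm S Γ b
  | lam {Γ : List (Ty Base)} {a b : Ty Base} (t : Tm S (a :: Γ) b) : Tm S Γ (.arr a b)

variable {S : Signature Base}

/-- Renamings of variables. -/
abbrev Ren (Γ Δ : List (Ty Base)) := ∀ τ : Ty Base, Var Γ τ → Var Δ τ

def Ren.lift {Γ Δ : List (Ty Base)} (r : Ren Γ Δ) (a : Ty Base) : Ren (a :: Γ) (a :: Δ)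
  | _, .zero => .zero
  | _, .succ x => .succ (r _ x)

def Tm.rename : {Γ Δ : List (Ty Base)} → {τ : Ty Base} → Ren Γ Δ → Tm S Γ τ → Tm S Δ τ
  | _, _, _, r, .var x => .var (r _ x)
  | _, _, _, _, .con c => .con c
  | _, _, _, _, .log c => .log c
  | _, _, _, _, .nom τ k => .nom τ k
  | _, _, _, r, .app f t => .app (f.rename r) (t.rename r)
  | _, _, _, r, .lam t => .lam (t.rename (r.lift _))

def Tm.weaken {Γ : List (Ty Base)} {τ : Ty Base} (a : Ty Base) (t : Tm S Γ τ) :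
    Tm S (a :: Γ) τ :=
  t.rename (fun _ x => .succ x)

/-- Simultaneous substitutions: `Sub S Γ Δ` assigns to the variables of `Γ` terms over `Δ`. -/
abbrev Sub (S : Signature Base) (Γ Δ : List (Ty Base)) := ∀ τ : Ty Base, Var Γ τ → Tm S Δ τ

def Sub.lift {Γ Δ : List (Ty Base)} (s : Sub S Γ Δ) (a : Ty Base) : Sub S (a :: Γ) (a :: Δ)
  | _, .zero => .var .zero
  | _, .succ x => (s _ x).weaken a

/-- Capture-avoiding simultaneous substitution. -/
def Tm.subst : {Γ Δ : List (Ty Base)} → {τ : Ty Base} → Sub S Γ Δ → Tm S Γ τ → Tm S Δ τ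
  | _, _, _, s, .var x => s _ x
  | _, _, _, _, .con c => .con c
  | _, _, _, _, .log c => .log c
  | _, _, _, _, .nom τ k => .nom τ k
  | _, _, _, s, .app f t => .app (f.subst s) (t.subst s)
  | _, _, _, s, .lam t => .lam (t.subst (s.lift _))

def Sub.single {Γ : List (Ty Base)} {a : Ty Base} (t : Tm S Γ a) : Sub S (a :: Γ) Γ
  | _, .zero => t
  | _, .succ x => .var x

/-- Beta-eta-conversion of typed terms (alpha-conversion is built into de Bruijn terms). -/
inductive Conv : {Γ : List (Ty Base)} → {τ : Ty Base} → Tm S Γ τ → Tm S Γ τ → Prop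
  | refl {Γ : List (Ty Base)} {τ : Ty Base} (t : Tm S Γ τ) : Conv t t
  | symm {Γ : List (Ty Base)} {τ : Ty Base} {t s : Tm S Γ τ} : Conv t s → Conv s t
  | trans {Γ : List (Ty Base)} {τ : Ty Base} {t s r : Tm S Γ τ} :
      Conv t s → Conv s r → Conv t r
  | app {Γ : List (Ty Base)} {a b : Ty Base} {f g : Tm S Γ (.arr a b)} {t s : Tm S Γ a} :
      Conv f g → Conv t s → Conv (.app f t) (.app g s)
  | lam {Γ : List (Ty Base)} {a b : Ty Base} {t s : Tm S (a :: Γ) b} :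
      Conv t s → Conv (.lam t) (.lam s)
  | beta {Γ : List (Ty Base)} {a b : Ty Base} (t : Tm S (a :: Γ) b) (s : Tm S Γ a) :
      Conv (.app (.lam t) s) (t.subst (Sub.single s))
  | eta {Γ : List (Ty Base)} {a b : Ty Base} (t : Tm S Γ (.arr a b)) :
      Conv (.lam (.app (t.weaken a) (.var .zero))) t

instance Tm.setoid (S : Signature Base) (τ : Ty Base) : Setoid (Tm S [] τ) where
  r := Conv
  iseqv := ⟨Conv.refl, Conv.symm, Conv.trans⟩

/-- Ground terms: closed terms modulo beta-eta-conversion. -/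
def Ground (S : Signature Base) (τ : Ty Base) : Type u := Quotient (Tm.setoid S τ)

/-- The ground term represented by a closed raw term. -/
def Tm.toGround {τ : Ty Base} (t : Tm S [] τ) : Ground S τ := Quotient.mk (Tm.setoid S τ) t

/-- Application of ground terms. -/
def Ground.app {a b : Ty Base} (f : Ground S (.arr a b)) (t : Ground S a) : Ground S b :=
  Quotient.map₂ Tm.app (fun _ _ hf _ _ ht => Conv.app hf ht) f t

/-- Ground formulas are ground terms of type `o`. -/
abbrev Formula (S : Signature Base) := Ground S (.o : Ty Base)

namespace Formula

def bot : Formula S := (Tm.log LogCon.bot).toGround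
def top : Formula S := (Tm.log LogCon.top).toGround
def and (A B : Formula S) : Formula S := ((Tm.log LogCon.and).toGround.app A).app B
def or (A B : Formula S) : Formula S := ((Tm.log LogCon.or).toGround.app A).app B
def imp (A B : Formula S) : Formula S := ((Tm.log LogCon.imp).toGround.app A).app B

/-- `all a h F` is the formula `∀ x : a, F x`; its instance at `t` is `F.app t`. -/
def all (a : Ty Base) (h : a.FirstOrder) (F : Ground S (.arr a .o)) : Formula S :=
  (Tm.log (LogCon.all a h)).toGround.app F
def ex (a : Ty Base) (h : a.FirstOrder) (F : Ground S (.arr a .o)) : Formula S :=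
  (Tm.log (LogCon.ex a h)).toGround.app F
def nab (a : Ty Base) (h : a.FirstOrder) (F : Ground S (.arr a .o)) : Formula S :=
  (Tm.log (LogCon.nab a h)).toGround.app F

end Formula

/-- `Spine S ω` is the type of tuples `t₁, …, tₙ` of ground terms with `ω = τ₁ → ⋯ → τₙ → o`. -/
inductive Spine (S : Signature Base) : Ty Base → Type u
  | nil : Spine S .o
  | cons {a b : Ty Base} (t : Ground S a) (ts : Spine S b) : Spine S (.arr a b)

/-- `f.apps ts` is the formula `f t₁ ⋯ tₙ`. -/
def Ground.apps : {w : Ty Base} → Ground S w → Spine S w → Formula S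
  | _, f, .nil => f
  | _, f, .cons t ts => (f.app t).apps ts

/-- The ground atom `p t₁ ⋯ tₙ`. -/
def atom {w : Ty Base} (p : S.Con w) (ts : Spine S w) : Formula S :=
  (Tm.con p).toGround.apps ts

def Formula.IsAtomic (A : Formula S) : Prop :=
  ∃ (w : Ty Base) (p : S.Con w) (ts : Spine S w), A = atom p ts

/-! ## Nominal constants, occurrences -/

/-- The `k`-th nominal constant of type `σ` occurs in a raw term. -/
def Tm.OccursNom (σ : Ty Base) (k : ℕ) : {Γ : List (Ty Base)} → {τ : Ty Base} → Tm S Γ τ → Prop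
  | _, _, .var _ => False
  | _, _, .con _ => False
  | _, _, .log _ => False
  | _, _, .nom τ j => τ = σ ∧ j = k
  | _, _, .app f t => f.OccursNom σ k ∨ t.OccursNom σ k
  | _, _, .lam t => t.OccursNom σ k

/-- The non-logical constant `p` occurs in a raw term. -/
def Tm.OccursCon {w : Ty Base} (p : S.Con w) :
    {Γ : List (Ty Base)} → {τ : Ty Base} → Tm S Γ τ → Prop
  | _, _, .var _ => False
  | _, τ, .con c => (⟨τ, c⟩ : Σ σ : Ty Base, S.Con σ) = ⟨w, p⟩
  | _, _, .log _ => False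
  | _, _, .nom _ _ => False
  | _, _, .app f t => f.OccursCon p ∨ t.OccursCon p
  | _, _, .lam t => t.OccursCon p

/-- The free variable with de Bruijn index `k` occurs in a raw term. -/
def Tm.OccursVar : {Γ : List (Ty Base)} → {τ : Ty Base} → Tm S Γ τ → ℕ → Prop
  | _, _, .var x, k => x.idx = k
  | _, _, .con _, _ => False
  | _, _, .log _, _ => False
  | _, _, .nom _ _, _ => False
  | _, _, .app f t, k => f.OccursVar k ∨ t.OccursVar k
  | _, _, .lam t, k => t.OccursVar (k + 1)

/-- No nominal constant occurs: the term has empty support. -/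
def Tm.NominalFree {Γ : List (Ty Base)} {τ : Ty Base} (t : Tm S Γ τ) : Prop :=
  ∀ (σ : Ty Base) (k : ℕ), ¬ t.OccursNom σ k

/-- The nominal constant `nom σ k` is not in the support of the ground term `t`. As conversion to
normal form never creates nominal constants, it is absent from the normal form exactly if it is
absent from some representative. -/
def Ground.Fresh {τ : Ty Base} (σ : Ty Base) (k : ℕ) (t : Ground S τ) : Prop :=
  ∃ r : Tm S [] τ, r.toGround = t ∧ ¬ r.OccursNom σ k

/-- The action of a type-preserving permutation of the nominal constants. -/
def Tm.permute (π : Ty Base → Equiv.Perm ℕ) :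
    {Γ : List (Ty Base)} → {τ : Ty Base} → Tm S Γ τ → Tm S Γ τ
  | _, _, .var x => .var x
  | _, _, .con c => .con c
  | _, _, .log c => .log c
  | _, _, .nom τ k => .nom τ (π τ k)
  | _, _, .app f t => .app (f.permute π) (t.permute π)
  | _, _, .lam t => .lam (t.permute π)

/-! ## The pattern fragment -/

/-- `FlexSpine k t l`: the term `t` is a free variable applied to distinct bound variables, whose
indices form the list `l`. Variables of index below `k` count as bound, the others as free. -/
inductive FlexSpine (k : ℕ) : {Γ : List (Ty Base)} → {τ : Ty Base} → Tm S Γ τ → List ℕ → Prop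
  | var {Γ : List (Ty Base)} {τ : Ty Base} (x : Var Γ τ) : k ≤ x.idx → FlexSpine k (.var x) []
  | app {Γ : List (Ty Base)} {a b : Ty Base} {f : Tm S Γ (.arr a b)} {l : List ℕ} (y : Var Γ a) :
      FlexSpine k f l → y.idx < k → y.idx ∉ l → FlexSpine k (.app f (.var y)) (y.idx :: l)

mutual

/-- A constant or bound variable applied to patterns. -/
inductive RigidSpine : (k : ℕ) → {Γ : List (Ty Base)} → {τ : Ty Base} → Tm S Γ τ → Prop
  | var {k : ℕ} {Γ : List (Ty Base)} {τ : Ty Base} (x : Var Γ τ) :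
      x.idx < k → RigidSpine k (.var x)
  | con {k : ℕ} {Γ : List (Ty Base)} {τ : Ty Base} (c : S.Con τ) :
      RigidSpine k (.con c : Tm S Γ τ)
  | log {k : ℕ} {Γ : List (Ty Base)} {τ : Ty Base} (c : LogCon τ) :
      RigidSpine k (.log c : Tm S Γ τ)
  | nom {k : ℕ} {Γ : List (Ty Base)} (τ : Ty Base) (j : ℕ) :
      RigidSpine k (.nom τ j : Tm S Γ τ)
  | app {k : ℕ} {Γ : List (Ty Base)} {a b : Ty Base} {f : Tm S Γ (.arr a b)} {t : Tm S Γ a} :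
      RigidSpine k f → IsPattern k t → RigidSpine k (.app f t)

/-- Beta-normal terms in which every free variable is applied to distinct bound variables only;
the variables of index below `k` are regarded as bound. -/
inductive IsPattern : (k : ℕ) → {Γ : List (Ty Base)} → {τ : Ty Base} → Tm S Γ τ → Prop
  | rigid {k : ℕ} {Γ : List (Ty Base)} {τ : Ty Base} {t : Tm S Γ τ} :
      RigidSpine k t → IsPattern k t
  | flex {k : ℕ} {Γ : List (Ty Base)} {τ : Ty Base} {t : Tm S Γ τ} {l : List ℕ} :
      FlexSpine k t l → IsPattern k t
  | lam {k : ℕ} {Γ : List (Ty Base)} {a b : Ty Base} {t : Tm S (a :: Γ) b} :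
      IsPattern (k + 1) t → IsPattern k (.lam t)

end

/-! ## Definitions and inductive definitions -/

/-- The raw term is of the form `p t₁ ⋯ tₙ`. -/
inductive Tm.HeadedBy {w : Ty Base} (p : S.Con w) :
    {Γ : List (Ty Base)} → {τ : Ty Base} → Tm S Γ τ → Prop
  | con {Γ : List (Ty Base)} : Tm.HeadedBy p (.con p : Tm S Γ w)
  | app {Γ : List (Ty Base)} {a b : Ty Base} {f : Tm S Γ (.arr a b)} (t : Tm S Γ a) :
      Tm.HeadedBy p f → Tm.HeadedBy p (.app f t)

/-- A definitional clause `head ≜ body` over the variable context `ctx`, with head and body given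
by representatives modulo conversion. -/
structure Clause (S : Signature Base) where
  ctx : List (Ty Base)
  head : Tm S ctx .o
  body : Tm S ctx .o

structure Clause.Valid (c : Clause S) : Prop where
  atomic : ∃ (w : Ty Base) (p : S.Con w), c.head.HeadedBy p
  head_nominalFree : c.head.NominalFree
  body_nominalFree : c.body.NominalFree
  pattern : IsPattern 0 c.head
  occurs : ∀ k < c.ctx.length, c.head.OccursVar k

/-- `A ≜ B'` is a ground instance of the clause `c`. -/
def Clause.Defn (c : Clause S) (A B' : Formula S) : Prop :=
  ∃ ρ : Sub S c.ctx [], (c.head.subst ρ).toGround = A ∧ (c.body.subst ρ).toGround = B'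

/-- An inductive clause `p x⃗ =μ B p x⃗`, with `B` given by a representative modulo conversion. -/
structure IndClause (S : Signature Base) where
  type : Ty Base
  pred : S.Con type
  op : Tm S [] (.arr type type)

structure IndClause.Valid (d : IndClause S) : Prop where
  propositional : d.type.Propositional
  nominalFree : d.op.NominalFree
  not_occurs : ¬ d.op.OccursCon d.pred

/-- The ground term `B T`, for `T` of the type of the defined predicate. -/
def IndClause.unfold (d : IndClause S) (T : Ground S d.type) : Ground S d.type :=
  d.op.toGround.app T

/-- The defined predicate as a ground term. -/
def IndClause.predTerm (d : IndClause S) : Ground S d.type := (Tm.con d.pred).toGround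

/-- The predicate `p` is defined by some clause of `D`. -/
def DefinedIn (D : Set (Clause S)) {w : Ty Base} (p : S.Con w) : Prop :=
  ∃ c ∈ D, c.head.HeadedBy p

/-- `A` is an atom whose predicate is not inductively defined. -/
def NonInductiveAtom (I : Set (IndClause S)) (A : Formula S) : Prop :=
  ∃ (w : Ty Base) (p : S.Con w) (ts : Spine S w), A = atom p ts ∧
    ∀ d ∈ I, (⟨d.type, d.pred⟩ : Σ σ : Ty Base, S.Con σ) ≠ ⟨w, p⟩

/-- Valid sets of definitions and of inductive definitions. -/
structure ValidDefs (D : Set (Clause S)) (I : Set (IndClause S)) : Prop where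
  clause_valid : ∀ c ∈ D, c.Valid
  ind_valid : ∀ d ∈ I, d.Valid
  ind_unique : ∀ d ∈ I, ∀ e ∈ I,
    (⟨d.type, d.pred⟩ : Σ σ : Ty Base, S.Con σ) = ⟨e.type, e.pred⟩ → d = e
  ind_not_defined : ∀ d ∈ I, ¬ DefinedIn D d.pred

/-! ## Levels and stratification -/

/-- `HasLevel lvl C a`: the formula `C` has level `a`, given the assignment `lvl` of levels to
ground atoms (the values of `lvl` at other formulas play no role). The level of `∇ x. C` is the
common level of the formulas `C[n/x]` with `n` not in the support of `C`. -/
inductive HasLevel (lvl : Formula S → Ordinal.{u}) : Formula S → Ordinal.{u} → Prop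
  | atom {A : Formula S} : A.IsAtomic → HasLevel lvl A (lvl A)
  | bot : HasLevel lvl Formula.bot 0
  | top : HasLevel lvl Formula.top 0
  | and {A B : Formula S} {a b : Ordinal.{u}} :
      HasLevel lvl A a → HasLevel lvl B b → HasLevel lvl (A.and B) (max a b)
  | or {A B : Formula S} {a b : Ordinal.{u}} :
      HasLevel lvl A a → HasLevel lvl B b → HasLevel lvl (A.or B) (max a b)
  | imp {A B : Formula S} {a b : Ordinal.{u}} :
      HasLevel lvl A a → HasLevel lvl B b → HasLevel lvl (A.imp B) (max (a + 1) b)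
  | all {α : Ty Base} (h : α.FirstOrder) {F : Ground S (.arr α .o)} {a : Ground S α → Ordinal.{u}} :
      (∀ t, HasLevel lvl (F.app t) (a t)) → HasLevel lvl (Formula.all α h F) (⨆ t, a t)
  | ex {α : Ty Base} (h : α.FirstOrder) {F : Ground S (.arr α .o)} {a : Ground S α → Ordinal.{u}} :
      (∀ t, HasLevel lvl (F.app t) (a t)) → HasLevel lvl (Formula.ex α h F) (⨆ t, a t)
  | nab {α : Ty Base} (h : α.FirstOrder) {F : Ground S (.arr α .o)} {a : Ordinal.{u}} :
      (∀ k : ℕ, F.Fresh α k → HasLevel lvl (F.app (Tm.nom α k).toGround) a) →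
        HasLevel lvl (Formula.nab α h F) a

/-- Every ground instance of a clause has a body whose level is at most that of its head. -/
def WeaklyStratified (lvl : Formula S → Ordinal.{u}) (D : Set (Clause S)) : Prop :=
  ∀ c ∈ D, ∀ A B : Formula S, c.Defn A B → ∃ b, HasLevel lvl B b ∧ b ≤ lvl A

/-- Strict stratification of inductive definitions: in addition the level of an inductively defined
atom does not depend on its arguments. -/
structure StrictlyStratified (lvl : Formula S → Ordinal.{u}) (I : Set (IndClause S)) : Prop where
  weak : ∀ d ∈ I, ∀ ts : Spine S d.type,
    ∃ b, HasLevel lvl ((d.unfold d.predTerm).apps ts) b ∧ b ≤ lvl (atom d.pred ts)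
  const : ∀ d ∈ I, ∀ ts us : Spine S d.type, lvl (atom d.pred ts) = lvl (atom d.pred us)

/-! ## The ground logic -/

/-- Derivability of ground sequents `Γ ⊢ C` in the infinitary ground logic over the definitions `D`
and the inductive definitions `I`. -/
inductive Derivable (D : Set (Clause S)) (I : Set (IndClause S)) :
    Multiset (Formula S) → Formula S → Prop
  | botL {Γ : Multiset (Formula S)} {C : Formula S} : Derivable D I (Formula.bot ::ₘ Γ) C
  | topR {Γ : Multiset (Formula S)} : Derivable D I Γ Formula.top
  | impL {Γ : Multiset (Formula S)} {A B C : Formula S} :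
      Derivable D I Γ A → Derivable D I (B ::ₘ Γ) C → Derivable D I (A.imp B ::ₘ Γ) C
  | impR {Γ : Multiset (Formula S)} {A B : Formula S} :
      Derivable D I (A ::ₘ Γ) B → Derivable D I Γ (A.imp B)
  | andL₁ {Γ : Multiset (Formula S)} {A B C : Formula S} :
      Derivable D I (A ::ₘ Γ) C → Derivable D I (A.and B ::ₘ Γ) C
  | andL₂ {Γ : Multiset (Formula S)} {A B C : Formula S} :
      Derivable D I (B ::ₘ Γ) C → Derivable D I (A.and B ::ₘ Γ) C
  | andR {Γ : Multiset (Formula S)} {A B : Formula S} :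
      Derivable D I Γ A → Derivable D I Γ B → Derivable D I Γ (A.and B)
  | orL {Γ : Multiset (Formula S)} {A B C : Formula S} :
      Derivable D I (A ::ₘ Γ) C → Derivable D I (B ::ₘ Γ) C → Derivable D I (A.or B ::ₘ Γ) C
  | orR₁ {Γ : Multiset (Formula S)} {A B : Formula S} :
      Derivable D I Γ A → Derivable D I Γ (A.or B)
  | orR₂ {Γ : Multiset (Formula S)} {A B : Formula S} :
      Derivable D I Γ B → Derivable D I Γ (A.or B)
  | allL {Γ : Multiset (Formula S)} {C : Formula S} {α : Ty Base} (h : α.FirstOrder)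
      {F : Ground S (.arr α .o)} (t : Ground S α) :
      Derivable D I (F.app t ::ₘ Γ) C → Derivable D I (Formula.all α h F ::ₘ Γ) C
  | allR {Γ : Multiset (Formula S)} {α : Ty Base} (h : α.FirstOrder) {F : Ground S (.arr α .o)} :
      (∀ t : Ground S α, Derivable D I Γ (F.app t)) → Derivable D I Γ (Formula.all α h F)
  | exL {Γ : Multiset (Formula S)} {C : Formula S} {α : Ty Base} (h : α.FirstOrder)
      {F : Ground S (.arr α .o)} :
      (∀ t : Ground S α, Derivable D I (F.app t ::ₘ Γ) C) →
        Derivable D I (Formula.ex α h F ::ₘ Γ) C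
  | exR {Γ : Multiset (Formula S)} {α : Ty Base} (h : α.FirstOrder) {F : Ground S (.arr α .o)}
      (t : Ground S α) :
      Derivable D I Γ (F.app t) → Derivable D I Γ (Formula.ex α h F)
  | nabL {Γ : Multiset (Formula S)} {C : Formula S} {α : Ty Base} (h : α.FirstOrder)
      {F : Ground S (.arr α .o)} (k : ℕ) (hk : F.Fresh α k) :
      Derivable D I (F.app (Tm.nom α k).toGround ::ₘ Γ) C →
        Derivable D I (Formula.nab α h F ::ₘ Γ) C
  | nabR {Γ : Multiset (Formula S)} {α : Ty Base} (h : α.FirstOrder) {F : Ground S (.arr α .o)}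
      (k : ℕ) (hk : F.Fresh α k) :
      Derivable D I Γ (F.app (Tm.nom α k).toGround) → Derivable D I Γ (Formula.nab α h F)
  | contrL {Γ : Multiset (Formula S)} {B C : Formula S} :
      Derivable D I (B ::ₘ B ::ₘ Γ) C → Derivable D I (B ::ₘ Γ) C
  | weakL {Γ : Multiset (Formula S)} {B C : Formula S} :
      Derivable D I Γ C → Derivable D I (B ::ₘ Γ) C
  | ax (A : Tm S [] .o) (π : Ty Base → Equiv.Perm ℕ) :
      Formula.IsAtomic A.toGround → Derivable D I {A.toGround} (A.permute π).toGround
  | mc {n : ℕ} {Γ : Multiset (Formula S)} {C : Formula S} (Δ : Fin n → Multiset (Formula S))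
      (A : Fin n → Formula S) :
      (∀ i, Derivable D I (Δ i) (A i)) → Derivable D I (Γ + Finset.univ.val.map A) C →
        Derivable D I (Γ + ∑ i, Δ i) C
  | defL {Γ : Multiset (Formula S)} {A C : Formula S} :
      NonInductiveAtom I A →
      (∀ c ∈ D, ∀ B : Formula S, c.Defn A B → Derivable D I (B ::ₘ Γ) C) →
        Derivable D I (A ::ₘ Γ) C
  | defR {Γ : Multiset (Formula S)} {A B : Formula S} (c : Clause S) (hc : c ∈ D) :
      c.Defn A B → Derivable D I Γ B → Derivable D I Γ A
  | indL {Γ : Multiset (Formula S)} {C : Formula S} (d : IndClause S) (hd : d ∈ I)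
      (T : Ground S d.type) (us : Spine S d.type) :
      (∀ ts : Spine S d.type, Derivable D I {(d.unfold T).apps ts} (T.apps ts)) →
        Derivable D I (T.apps us ::ₘ Γ) C → Derivable D I (atom d.pred us ::ₘ Γ) C
  | indR {Γ : Multiset (Formula S)} (d : IndClause S) (hd : d ∈ I) (ts : Spine S d.type) :
      Derivable D I Γ ((d.unfold d.predTerm).apps ts) → Derivable D I Γ (atom d.pred ts)

/-- Consistency: the sequent `⊢ ⊥` is not derivable. -/
def Consistent (D : Set (Clause S)) (I : Set (IndClause S)) : Prop :=
  ¬ Derivable D I 0 Formula.bot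

end LD

-- Consistency is proved semantically: a two-valued model is built in which every derivable sequent
-- is true and `⊥` is false. No cut elimination is needed, since multicut is sound in any model.
--
-- Terms are interpreted in a set-theoretic model glued to the ground terms: an element of type `o`
-- is a formula together with a truth value, and an element of a function type is a ground term
-- together with a compatible function. The syntactic component is needed because atoms depend on
-- their arguments as terms, and these may contain formulas, for instance below nominals of type `o
-- → b`. Elements of first-order type carry no information beyond their term
-- (`Sem.eq_of_firstOrder`), so quantifiers range exactly over ground terms. Thus every valuation of
-- the atoms gives a truth value to every formula, whether or not it has a level. `∇` means "for all
-- but finitely many nominals".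
--
-- The valuation is built by recursion on levels, taking at each level the least set of atoms closed
-- under the clauses. Stratification makes clause bodies monotone in the atoms of the current level
-- (`LevelLE.holds_mono`), so the least set is a fixed point; this validates the rules for
-- definitions. The given levels need not be invariant under permutations of nominals, so they are
-- first replaced by their minima over permutations, which preserves stratification
-- (`Unfolds.levelLE`). The model is then invariant as well (`leastModel_permute`), which validates
-- the axiom rule and reduces `∇` to any single fresh nominal.
--
-- For `μL` the invariant is an arbitrary closed term, with no bound on its level. Two facts
-- suffice: leastness gives induction for arbitrary sets of argument tuples (`leastModel_ind`, where
-- strict stratification puts all atoms of the predicate on one level), and the operator of a clause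
-- cannot distinguish its predicate, revalued as the extension of a term, from that term
-- (`IndClause.Valid.holds_unfold`, by a logical relation that forgets the syntactic component of
-- propositions).

namespace LD

variable {Base : Type u} {S : Signature Base}

/-! ## Simultaneous replacement of variables and nominal constants -/

/-- Assignments of terms to nominal constants. -/
abbrev NomSub (S : Signature Base) (Δ : List (Ty Base)) := ∀ τ : Ty Base, ℕ → Tm S Δ τ

/-- Capture-avoiding simultaneous replacement of variables and nominal constants. -/
def Tm.inst : {Γ Δ : List (Ty Base)} → {τ : Ty Base} → NomSub S Δ → Sub S Γ Δ →
    Tm S Γ τ → Tm S Δ τ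
  | _, _, _, _, s, .var x => s _ x
  | _, _, _, _, _, .con c => .con c
  | _, _, _, _, _, .log c => .log c
  | _, _, _, θ, _, .nom τ k => θ τ k
  | _, _, _, θ, s, .app f t => .app (f.inst θ s) (t.inst θ s)
  | _, _, _, θ, s, .lam t => .lam (t.inst (fun τ k => (θ τ k).weaken _) (s.lift _))

/-- Extension of a substitution by a term for the innermost variable. -/
def Sub.cons {Γ Δ : List (Ty Base)} {a : Ty Base} (t : Tm S Δ a) (s : Sub S Γ Δ) :
    Sub S (a :: Γ) Δ
  | _, .zero => t
  | _, .succ x => s _ x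

theorem Ren.lift_comp {Γ Δ Ξ : List (Ty Base)} (r : Ren Γ Δ) (q : Ren Δ Ξ) (a : Ty Base) :
    (fun τ x => (q.lift a) τ ((r.lift a) τ x)) = Ren.lift (fun τ x => q τ (r τ x)) a := by
  funext τ x
  cases x <;> rfl

theorem Tm.rename_rename {Γ Δ Ξ : List (Ty Base)} {τ : Ty Base} (t : Tm S Γ τ) (r : Ren Γ Δ)
    (q : Ren Δ Ξ) : (t.rename r).rename q = t.rename (fun τ x => q τ (r τ x)) := by
  induction t generalizing Δ Ξ with
  | app f t hf ht => simp only [Tm.rename, hf, ht]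
  | lam t ht => simp only [Tm.rename, ht, Ren.lift_comp]
  | _ => rfl

theorem Tm.weaken_rename {Γ Δ : List (Ty Base)} {τ : Ty Base} (t : Tm S Γ τ) (r : Ren Γ Δ)
    (a : Ty Base) : (t.weaken a).rename (r.lift a) = (t.rename r).weaken a := by
  simp only [Tm.weaken, Tm.rename_rename]
  rfl

/-- Renamings, substitutions and permutations are all instances of `Tm.inst`, so that composition
laws and stability of conversion are needed for this one operation only. -/
theorem Tm.rename_eq_inst {Γ Δ : List (Ty Base)} {τ : Ty Base} (t : Tm S Γ τ) (r : Ren Γ Δ) :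
    t.rename r = t.inst Tm.nom (fun τ x => .var (r τ x)) := by
  induction t generalizing Δ with
  | app f t hf ht => simp only [Tm.rename, Tm.inst, hf, ht]
  | lam t ht =>
    simp only [Tm.rename, Tm.inst, ht]
    congr 2
    funext τ x
    cases x <;> rfl
  | _ => rfl

theorem Tm.subst_eq_inst {Γ Δ : List (Ty Base)} {τ : Ty Base} (t : Tm S Γ τ) (s : Sub S Γ Δ) :
    t.subst s = t.inst Tm.nom s := by
  induction t generalizing Δ with
  | app f t hf ht => simp only [Tm.subst, Tm.inst, hf, ht]
  | lam t ht =>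
    simp only [Tm.subst, Tm.inst, ht]
    rfl
  | _ => rfl

theorem Tm.permute_eq_inst {Γ : List (Ty Base)} {τ : Ty Base} (t : Tm S Γ τ)
    (π : Ty Base → Equiv.Perm ℕ) :
    t.permute π = t.inst (fun τ k => .nom τ (π τ k)) (fun _ x => .var x) := by
  induction t with
  | app f t hf ht => simp only [Tm.permute, Tm.inst, hf, ht]
  | lam t ht =>
    simp only [Tm.permute, Tm.inst, ht]
    congr 2
    funext τ x
    cases x <;> rfl
  | _ => rfl

theorem Tm.rename_inst {Γ Δ Ξ : List (Ty Base)} {τ : Ty Base} (t : Tm S Γ τ) (r : Ren Γ Δ)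
    (θ : NomSub S Ξ) (s : Sub S Δ Ξ) :
    (t.rename r).inst θ s = t.inst θ (fun τ x => s τ (r τ x)) := by
  induction t generalizing Δ Ξ with
  | app f t hf ht => simp only [Tm.rename, Tm.inst, hf, ht]
  | lam t ht =>
    simp only [Tm.rename, Tm.inst, ht]
    congr 2
    funext τ x
    cases x <;> rfl
  | _ => rfl

theorem Tm.inst_rename {Γ Δ Ξ : List (Ty Base)} {τ : Ty Base} (t : Tm S Γ τ)
    (θ : NomSub S Δ) (s : Sub S Γ Δ) (r : Ren Δ Ξ) :
    (t.inst θ s).rename r =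
      t.inst (fun τ k => (θ τ k).rename r) (fun τ x => (s τ x).rename r) := by
  induction t generalizing Δ Ξ with
  | app f t hf ht => simp only [Tm.rename, Tm.inst, hf, ht]
  | lam t ht =>
    simp only [Tm.rename, Tm.inst, ht]
    congr 2
    · funext τ k
      exact Tm.weaken_rename _ _ _
    · funext τ x
      cases x
      · rfl
      · exact Tm.weaken_rename _ _ _
  | _ => rfl

theorem Tm.weaken_inst {Γ Δ : List (Ty Base)} {τ : Ty Base} (t : Tm S Γ τ) (a : Ty Base)
    (θ : NomSub S Δ) (s : Sub S Γ Δ) :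
    (t.weaken a).inst (fun τ k => (θ τ k).weaken a) (s.lift a) = (t.inst θ s).weaken a := by
  simp only [Tm.weaken, Tm.rename_inst, Tm.inst_rename]
  rfl

/-- Below a binder the second replacement meets weakened terms. The composition law therefore rests
on the cases in which one of the two factors is a renaming, combined in `Tm.weaken_inst`. -/
theorem Tm.inst_inst {Γ Δ Ξ : List (Ty Base)} {τ : Ty Base} (t : Tm S Γ τ)
    (θ : NomSub S Δ) (s : Sub S Γ Δ) (θ' : NomSub S Ξ) (s' : Sub S Δ Ξ) :
    (t.inst θ s).inst θ' s' =
      t.inst (fun τ k => (θ τ k).inst θ' s') (fun τ x => (s τ x).inst θ' s') := by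
  induction t generalizing Δ Ξ with
  | app f t hf ht => simp only [Tm.inst, hf, ht]
  | lam t ht =>
    simp only [Tm.inst, ht]
    congr 2
    · funext τ k
      exact Tm.weaken_inst _ _ _ _
    · funext τ x
      cases x
      · rfl
      · exact Tm.weaken_inst _ _ _ _
  | _ => rfl

theorem Tm.inst_nom_var {Γ : List (Ty Base)} {τ : Ty Base} (t : Tm S Γ τ) :
    t.inst Tm.nom (fun _ x => .var x) = t := by
  -- The identity replacement is the identity permutation, whose action does not change below
  -- binders.
  have h := t.permute_eq_inst 1
  have h' : t.permute 1 = t := by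
    clear h
    induction t with
    | app f t hf ht => simp only [Tm.permute, hf, ht]
    | lam t ht => simp only [Tm.permute, ht]
    | _ => rfl
  rw [h'] at h
  exact h.symm

theorem Tm.inst_congr_nom {Γ Δ : List (Ty Base)} {τ : Ty Base} (t : Tm S Γ τ)
    {θ θ' : NomSub S Δ} (s : Sub S Γ Δ) (h : ∀ σ k, t.OccursNom σ k → θ σ k = θ' σ k) :
    t.inst θ s = t.inst θ' s := by
  induction t generalizing Δ with
  | nom τ k => exact h _ _ ⟨rfl, rfl⟩
  | app f t hf ht =>
    simp only [Tm.inst]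
    rw [hf s fun σ k hk => h σ k (.inl hk), ht s fun σ k hk => h σ k (.inr hk)]
  | lam t ht =>
    simp only [Tm.inst]
    rw [ht]
    intro σ k hk
    rw [h σ k hk]
  | _ => rfl

theorem Tm.lift_inst_single {Γ Δ : List (Ty Base)} {a b : Ty Base} (t : Tm S (a :: Γ) b)
    (u : Tm S Δ a) (θ : NomSub S Δ) (s : Sub S Γ Δ) :
    (t.inst (fun τ k => (θ τ k).weaken a) (s.lift a)).subst (Sub.single u) =
      t.inst θ (Sub.cons u s) := by
  have h : ∀ {τ : Ty Base} (r : Tm S Δ τ), (r.weaken a).inst Tm.nom (Sub.single u) = r := by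
    intro τ r
    rw [Tm.weaken, Tm.rename_inst]
    exact r.inst_nom_var
  rw [Tm.subst_eq_inst, Tm.inst_inst]
  congr 1
  · funext τ k
    exact h _
  · funext τ x
    cases x
    · rfl
    · exact h _

theorem Tm.subst_lift_single {Γ Δ : List (Ty Base)} {a b : Ty Base} (t : Tm S (a :: Γ) b)
    (u : Tm S Δ a) (s : Sub S Γ Δ) :
    (t.subst (s.lift a)).subst (Sub.single u) = t.subst (Sub.cons u s) := by
  rw [Tm.subst_eq_inst t (Sub.cons u s), ← Tm.lift_inst_single, Tm.subst_eq_inst t]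
  rfl

/-- Nominals behave like free variables: no conversion rule mentions them. Hence they may be
permuted, and also be abstracted to a variable, without affecting convertibility. -/
theorem Conv.inst {Γ Δ : List (Ty Base)} {τ : Ty Base} {t t' : Tm S Γ τ} (h : Conv t t')
    (θ : NomSub S Δ) (s : Sub S Γ Δ) : Conv (t.inst θ s) (t'.inst θ s) := by
  induction h generalizing Δ with
  | refl t => exact .refl _
  | symm _ ih => exact (ih θ s).symm
  | trans _ _ ih ih' => exact (ih θ s).trans (ih' θ s)
  | app _ _ ih ih' => exact .app (ih θ s) (ih' θ s)
  | lam _ ih => exact .lam (ih _ _)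
  | beta t u =>
    have h := Conv.beta (t.inst (fun τ k => (θ τ k).weaken _) (s.lift _)) (u.inst θ s)
    rw [Tm.lift_inst_single] at h
    rw [Tm.subst_eq_inst t, Tm.inst_inst]
    have e : (fun τ x => (Sub.single u τ x).inst θ s) = Sub.cons (u.inst θ s) s := by
      funext τ x
      cases x <;> rfl
    rw [e]
    exact h
  | eta t =>
    have h := Conv.eta (t.inst θ s)
    rw [← Tm.weaken_inst] at h
    exact h

theorem Tm.finite_occursNom {Γ : List (Ty Base)} {τ : Ty Base} (t : Tm S Γ τ) (σ : Ty Base) :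
    {k | t.OccursNom σ k}.Finite := by
  induction t with
  | nom τ j => exact (Set.finite_singleton j).subset fun k hk => hk.2.symm
  | app f t hf ht => exact hf.union ht
  | lam t ht => exact ht
  | _ => exact Set.finite_empty.subset fun k hk => hk

/-- Abstraction of a nominal constant by the innermost variable. -/
noncomputable def NomSub.abstract (S : Signature Base) (a : Ty Base) (k : ℕ) : NomSub S [a] :=
  fun τ j => open Classical in
    if h : a = τ ∧ j = k then h.1 ▸ (Tm.var Var.zero : Tm S [a] a) else .nom τ j

theorem Tm.inst_abstract {τ a : Ty Base} {k : ℕ} (t : Tm S [] τ) (s : Sub S [] [a])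
    (h : ¬ t.OccursNom a k) : t.inst (NomSub.abstract S a k) s = t.weaken a := by
  rw [Tm.weaken, Tm.rename_eq_inst, Tm.inst_congr_nom (θ' := Tm.nom)]
  · congr 1
    funext τ x
    cases x
  · intro σ j hj
    refine dif_neg ?_
    rintro ⟨rfl, rfl⟩
    exact h hj

/-- Ground terms are extensional, as there are infinitely many nominal constants. -/
theorem Ground.ext_app {a b : Ty Base} {f g : Ground S (.arr a b)}
    (h : ∀ t, f.app t = g.app t) : f = g := by
  induction f, g using Quotient.inductionOn₂ with
  | _ f g =>
  obtain ⟨k, hk⟩ :=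
    ((f.finite_occursNom a).union (g.finite_occursNom a)).infinite_compl.nonempty
  simp only [Set.mem_compl_iff, Set.mem_union, Set.mem_ofPred_eq, not_or] at hk
  have h' : Conv (.app f (.nom a k)) (.app g (.nom a k)) :=
    Quotient.exact (h (Tm.nom a k).toGround)
  -- The nominal `k` occurs in neither term, so turning it into a variable leaves a conversion
  -- between the bodies of the two eta-expansions.
  have h'' := h'.inst (NomSub.abstract S a k) (fun _ x => nomatch x)
  simp only [Tm.inst, Tm.inst_abstract _ _ hk.1, Tm.inst_abstract _ _ hk.2] at h''
  have e : NomSub.abstract S a k a k = .var .zero := dif_pos ⟨rfl, rfl⟩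
  rw [e] at h''
  exact Quotient.sound ((Conv.eta f).symm.trans ((Conv.lam h'').trans (Conv.eta g)))

/-! ## Permutations of nominal constants -/

/-- The action of a permutation of the nominal constants on ground terms. -/
def Ground.permute (π : Ty Base → Equiv.Perm ℕ) {τ : Ty Base} (t : Ground S τ) : Ground S τ :=
  Quotient.map (Tm.permute π) (fun a b (h : Conv a b) => by
    simp only [Tm.permute_eq_inst]
    exact h.inst _ _) t

theorem Tm.toGround_permute (π : Ty Base → Equiv.Perm ℕ) {τ : Ty Base} (t : Tm S [] τ) :
    (t.permute π).toGround = t.toGround.permute π := rfl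

theorem Ground.permute_app (π : Ty Base → Equiv.Perm ℕ) {a b : Ty Base}
    (f : Ground S (.arr a b)) (t : Ground S a) :
    (f.app t).permute π = (f.permute π).app (t.permute π) := by
  induction f, t using Quotient.inductionOn₂
  rfl

theorem Tm.permute_inv (π : Ty Base → Equiv.Perm ℕ) {Γ : List (Ty Base)} {τ : Ty Base}
    (t : Tm S Γ τ) : (t.permute π⁻¹).permute π = t := by
  induction t with
  | nom τ k => simp [Tm.permute]
  | app f t hf ht => simp only [Tm.permute, hf, ht]
  | lam t ht => simp only [Tm.permute, ht]
  | _ => rfl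

theorem Tm.permute_mul (π ρ : Ty Base → Equiv.Perm ℕ) {Γ : List (Ty Base)} {τ : Ty Base}
    (t : Tm S Γ τ) : t.permute (π * ρ) = (t.permute ρ).permute π := by
  induction t with
  | nom τ k => simp [Tm.permute]
  | app f t hf ht => simp only [Tm.permute, hf, ht]
  | lam t ht => simp only [Tm.permute, ht]
  | _ => rfl

theorem Ground.permute_mul (π ρ : Ty Base → Equiv.Perm ℕ) {τ : Ty Base} (t : Ground S τ) :
    t.permute (π * ρ) = (t.permute ρ).permute π := by
  induction t using Quotient.inductionOn with
  | _ t => exact congrArg Tm.toGround (t.permute_mul π ρ)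

theorem Ground.permute_permute_inv (π : Ty Base → Equiv.Perm ℕ) {τ : Ty Base}
    (t : Ground S τ) : (t.permute π⁻¹).permute π = t := by
  induction t using Quotient.inductionOn with
  | _ t => exact congrArg Tm.toGround (t.permute_inv π)

theorem Ground.permute_inv_permute (π : Ty Base → Equiv.Perm ℕ) {τ : Ty Base}
    (t : Ground S τ) : (t.permute π).permute π⁻¹ = t := by
  simpa using t.permute_permute_inv π⁻¹

theorem Ground.permute_one {τ : Ty Base} (t : Ground S τ) : t.permute 1 = t := by
  simpa [← Ground.permute_mul] using t.permute_permute_inv 1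

theorem Tm.permute_eq_self {Γ : List (Ty Base)} {τ : Ty Base} (t : Tm S Γ τ)
    {π : Ty Base → Equiv.Perm ℕ} (h : ∀ σ k, t.OccursNom σ k → π σ k = k) :
    t.permute π = t := by
  rw [Tm.permute_eq_inst, Tm.inst_congr_nom (θ' := Tm.nom), Tm.inst_nom_var]
  intro σ k hk
  rw [h σ k hk]

/-- A permutation moves only the nominals that the substitution brings in. This makes the ground
instances of clauses closed under permutations. -/
theorem Tm.NominalFree.subst_permute {Γ : List (Ty Base)} {τ : Ty Base} {t : Tm S Γ τ}
    (h : t.NominalFree) (s : Sub S Γ []) (π : Ty Base → Equiv.Perm ℕ) :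
    (t.subst s).permute π = t.subst (fun τ x => (s τ x).permute π) := by
  simp only [Tm.permute_eq_inst, Tm.subst_eq_inst, Tm.inst_inst]
  exact t.inst_congr_nom _ fun σ k hk => (h σ k hk).elim

/-- The action of a permutation of the nominal constants on tuples. -/
def Spine.permute (π : Ty Base → Equiv.Perm ℕ) : {w : Ty Base} → Spine S w → Spine S w
  | _, .nil => .nil
  | _, .cons t ts => .cons (t.permute π) (ts.permute π)

theorem Spine.permute_permute_inv (π : Ty Base → Equiv.Perm ℕ) {w : Ty Base}
    (ts : Spine S w) : (ts.permute π⁻¹).permute π = ts := by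
  induction ts with
  | nil => rfl
  | cons t ts ih => simp only [Spine.permute, ih, Ground.permute_permute_inv]

theorem Spine.permute_inv_permute (π : Ty Base → Equiv.Perm ℕ) {w : Ty Base}
    (ts : Spine S w) : (ts.permute π).permute π⁻¹ = ts := by
  simpa using ts.permute_permute_inv π⁻¹

theorem Spine.permute_one {w : Ty Base} (ts : Spine S w) : ts.permute 1 = ts := by
  induction ts with
  | nil => rfl
  | cons t ts ih => simp only [Spine.permute, ih, Ground.permute_one]

theorem Ground.permute_apps (π : Ty Base → Equiv.Perm ℕ) {w : Ty Base} (f : Ground S w)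
    (ts : Spine S w) : (f.apps ts).permute π = (f.permute π).apps (ts.permute π) := by
  induction ts with
  | nil => rfl
  | cons t ts ih => rw [Ground.apps, ih, Ground.permute_app]; rfl

theorem atom_permute (π : Ty Base → Equiv.Perm ℕ) {w : Ty Base} (p : S.Con w)
    (ts : Spine S w) : (atom p ts).permute π = atom p (ts.permute π) :=
  Ground.permute_apps π _ ts

/-! ## A set-theoretic model glued to the ground terms -/

/-- The domains of the model, with the projections to ground terms. Propositions are interpreted
by pairs of a formula and a truth value, functions by pairs of a ground term and a function that
is compatible with the application of this term. -/
def Dom (S : Signature Base) : (τ : Ty Base) → (X : Type u) × (X → Ground S τ)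
  | .base b => ⟨Ground S (.base b), id⟩
  | .o => ⟨Formula S × Prop, Prod.fst⟩
  | .arr a b =>
    ⟨{ x : Ground S (.arr a b) × ((Dom S a).1 → (Dom S b).1) //
        ∀ d, (Dom S b).2 (x.2 d) = x.1.app ((Dom S a).2 d) }, fun x => x.1.1⟩

/-- The domain of a type in the model. -/
def Sem (S : Signature Base) (τ : Ty Base) : Type u := (Dom S τ).1

namespace Sem

/-- The ground term of an element of the model. -/
def term {τ : Ty Base} (d : Sem S τ) : Ground S τ := (Dom S τ).2 d

def app {a b : Ty Base} (f : Sem S (.arr a b)) (d : Sem S a) : Sem S b := f.1.2 d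

def lam {a b : Ty Base} (g : Ground S (.arr a b)) (f : Sem S a → Sem S b)
    (h : ∀ d, (f d).term = g.app d.term) : Sem S (.arr a b) := ⟨(g, f), h⟩

def prop (A : Formula S) (P : Prop) : Sem S .o := (A, P)

/-- The truth value of an element of the model of type `o`. -/
def holds (d : Sem S .o) : Prop := Prod.snd (α := Formula S) d

@[simp] theorem term_lam {a b : Ty Base} (g : Ground S (.arr a b)) (f : Sem S a → Sem S b)
    (h : ∀ d, (f d).term = g.app d.term) : (lam g f h).term = g := rfl

@[simp] theorem app_lam {a b : Ty Base} (g : Ground S (.arr a b)) (f : Sem S a → Sem S b)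
    (h : ∀ d, (f d).term = g.app d.term) (d : Sem S a) : (lam g f h).app d = f d := rfl

@[simp] theorem term_prop (A : Formula S) (P : Prop) : (prop A P).term = A := rfl

@[simp] theorem holds_prop (A : Formula S) (P : Prop) : (prop A P).holds = P := rfl

theorem term_app {a b : Ty Base} (f : Sem S (.arr a b)) (d : Sem S a) :
    (f.app d).term = f.term.app d.term := f.2 d

/-- The element over a ground term given by a predicate on its tuples of arguments. -/
def ofTermAux : (τ : Ty Base) → (g : Ground S τ) → (Spine S τ → Prop) →
    { d : Sem S τ // d.term = g }
  | .base _, g, _ => ⟨g, rfl⟩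
  | .o, g, P => ⟨prop g (P .nil), rfl⟩
  | .arr _ b, g, P =>
    ⟨lam g (fun d => (ofTermAux b (g.app d.term) fun ts => P (.cons d.term ts)).1)
      fun d => (ofTermAux b (g.app d.term) fun ts => P (.cons d.term ts)).2, rfl⟩

/-- The element over a ground term given by a predicate on its tuples of arguments. -/
def ofTerm {τ : Ty Base} (g : Ground S τ) (P : Spine S τ → Prop) : Sem S τ :=
  (ofTermAux τ g P).1

@[simp] theorem term_ofTerm {τ : Ty Base} (g : Ground S τ) (P : Spine S τ → Prop) :
    (ofTerm g P).term = g := (ofTermAux τ g P).2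

@[simp] theorem app_ofTerm {a b : Ty Base} (g : Ground S (.arr a b))
    (P : Spine S (.arr a b) → Prop) (d : Sem S a) :
    (ofTerm g P).app d = ofTerm (g.app d.term) fun ts => P (.cons d.term ts) := rfl

@[simp] theorem holds_ofTerm (g : Formula S) (P : Spine S .o → Prop) :
    (ofTerm g P).holds = P .nil := rfl

/-- The element over a ground term all of whose truth values are false. -/
def default {τ : Ty Base} (g : Ground S τ) : Sem S τ := ofTerm g fun _ => False

@[simp] theorem term_default {τ : Ty Base} (g : Ground S τ) : (default g).term = g :=
  term_ofTerm _ _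

/-- The function component alone suffices: applied to default elements it shows how the ground term
acts on all ground terms, and ground terms are extensional. -/
theorem ext {a b : Ty Base} {f g : Sem S (.arr a b)} (h : ∀ d, f.app d = g.app d) : f = g := by
  have h' : f.term = g.term := Ground.ext_app fun t => by
    have := congrArg term (h (default t))
    simpa [term_app] using this
  exact Subtype.ext (Prod.ext h' (funext h))

/-- Elements of first-order type are determined by their terms. -/
theorem eq_of_firstOrder {τ : Ty Base} (hτ : τ.FirstOrder) {d e : Sem S τ}
    (h : d.term = e.term) : d = e := by
  induction τ with
  | base b => exact h
  | o => exact hτ.elim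
  | arr a b _ hb =>
    refine ext fun x => hb hτ.2 ?_
    rw [term_app, term_app, h]

end Sem

-- Interpretation of terms and truth of formulas

/-- Valuations of the predicate constants. -/
abbrev Val (S : Signature Base) := ∀ w : Ty Base, S.Con w → Spine S w → Prop

/-- The interpretation of the connectives. -/
def Sem.connective (c : LogCon (.arr .o (.arr .o .o) : Ty Base)) (op : Prop → Prop → Prop) :
    Sem S (.arr .o (.arr .o .o)) :=
  .lam (Tm.log c).toGround
    (fun d => .lam ((Tm.log c).toGround.app d.term)
      (fun e => .prop (((Tm.log c).toGround.app d.term).app e.term) (op d.holds e.holds))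
      fun _ => rfl)
    fun _ => rfl

/-- The interpretation of the quantifiers. -/
def Sem.quantifier {a : Ty Base} (c : LogCon (.arr (.arr a .o) .o))
    (op : (Ground S a → Prop) → Prop) : Sem S (.arr (.arr a .o) .o) :=
  .lam (Tm.log c).toGround
    (fun F => .prop ((Tm.log c).toGround.app F.term) (op fun t => (F.app (.default t)).holds))
    fun _ => rfl

/-- The interpretation of the logical constants; `∇ x. C` holds if all but finitely many of the
instances of `C` with nominal constants hold. -/
def Sem.log (S : Signature Base) : {τ : Ty Base} → LogCon τ → Sem S τ
  | _, .bot => .prop Formula.bot False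
  | _, .top => .prop Formula.top True
  | _, .and => .connective .and And
  | _, .or => .connective .or Or
  | _, .imp => .connective .imp fun P Q => P → Q
  | _, .all a h => .quantifier (.all a h) fun P => ∀ t, P t
  | _, .ex a h => .quantifier (.ex a h) fun P => ∃ t, P t
  | _, .nab a h =>
    .quantifier (.nab a h) fun P => ∀ᶠ k in Filter.cofinite, P (Tm.nom a k).toGround

theorem Sem.term_log {τ : Ty Base} (c : LogCon τ) :
    (Sem.log S c).term = (Tm.log c).toGround := by
  cases c <;> rfl

/-- Environments assign elements of the model to variables. -/
abbrev Env (S : Signature Base) (Γ : List (Ty Base)) := ∀ τ : Ty Base, Var Γ τ → Sem S τ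

def Env.cons {Γ : List (Ty Base)} {a : Ty Base} (d : Sem S a) (ρ : Env S Γ) : Env S (a :: Γ)
  | _, .zero => d
  | _, .succ x => ρ _ x

def Env.nil : Env S [] := fun _ x => nomatch x

/-- The substitution of representatives of the terms of an environment. -/
noncomputable def Env.rep {Γ : List (Ty Base)} (ρ : Env S Γ) : Sub S Γ [] :=
  fun τ x => (ρ τ x).term.out

theorem Ground.toGround_out {τ : Ty Base} (g : Ground S τ) : Tm.toGround g.out = g :=
  Quotient.out_eq g

/-- This is the compatibility of the two components of an interpreted abstraction; on the syntactic
side it is a beta step. -/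
theorem Env.toGround_subst_cons {Γ : List (Ty Base)} {a b : Ty Base} (t : Tm S (a :: Γ) b)
    (ρ : Env S Γ) (d : Sem S a) :
    (t.subst (ρ.cons d).rep).toGround = ((Tm.lam t).subst ρ.rep).toGround.app d.term := by
  have h : (ρ.cons d).rep = Sub.cons d.term.out ρ.rep := by
    funext τ x
    cases x <;> rfl
  rw [h, ← Tm.subst_lift_single, ← d.term.toGround_out]
  conv_lhs => rw [Ground.toGround_out]
  exact (Quotient.sound (Conv.beta _ _)).symm

/-- The interpretation of terms. -/
noncomputable def Tm.evalAux (v : Val S) : {Γ : List (Ty Base)} → {τ : Ty Base} →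
    (t : Tm S Γ τ) → (ρ : Env S Γ) → { d : Sem S τ // d.term = (t.subst ρ.rep).toGround }
  | _, _, .var x, ρ => ⟨ρ _ x, (Ground.toGround_out _).symm⟩
  | _, τ, .con c, _ => ⟨.ofTerm (Tm.con c).toGround (v τ c), Sem.term_ofTerm _ _⟩
  | _, _, .log c, _ => ⟨.log S c, Sem.term_log c⟩
  | _, _, .nom τ k, _ => ⟨.default (Tm.nom τ k).toGround, Sem.term_default _⟩
  | _, _, .app f t, ρ => ⟨(f.evalAux v ρ).1.app (t.evalAux v ρ).1, by
      rw [Sem.term_app, (f.evalAux v ρ).2, (t.evalAux v ρ).2]; rfl⟩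
  | _, _, .lam t, ρ => ⟨.lam ((Tm.lam t).subst ρ.rep).toGround
      (fun d => (t.evalAux v (ρ.cons d)).1) fun d => by
        rw [(t.evalAux v (ρ.cons d)).2, Env.toGround_subst_cons], rfl⟩

/-- The interpretation of terms. -/
noncomputable def Tm.eval (v : Val S) {Γ : List (Ty Base)} {τ : Ty Base} (t : Tm S Γ τ)
    (ρ : Env S Γ) : Sem S τ := (t.evalAux v ρ).1

section eval
variable (v : Val S) {Γ Δ : List (Ty Base)}

theorem Tm.term_eval {τ : Ty Base} (t : Tm S Γ τ) (ρ : Env S Γ) :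
    (t.eval v ρ).term = (t.subst ρ.rep).toGround := (t.evalAux v ρ).2

theorem Tm.eval_con {τ : Ty Base} (c : S.Con τ) (ρ : Env S Γ) :
    (Tm.con c).eval v ρ = .ofTerm (Tm.con c).toGround (v τ c) := rfl

theorem Tm.eval_app {a b : Ty Base} (f : Tm S Γ (.arr a b)) (t : Tm S Γ a) (ρ : Env S Γ) :
    (Tm.app f t).eval v ρ = (f.eval v ρ).app (t.eval v ρ) := rfl

theorem Tm.app_eval_lam {a b : Ty Base} (t : Tm S (a :: Γ) b) (ρ : Env S Γ) (d : Sem S a) :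
    ((Tm.lam t).eval v ρ).app d = t.eval v (ρ.cons d) := rfl

theorem Tm.eval_rename {τ : Ty Base} (t : Tm S Γ τ) (r : Ren Γ Δ) (ρ : Env S Δ) :
    (t.rename r).eval v ρ = t.eval v (fun τ x => ρ τ (r τ x)) := by
  induction t generalizing Δ with
  | app f t hf ht => simp only [Tm.rename, Tm.eval_app, hf, ht]
  | lam t ht =>
    refine Sem.ext fun d => ?_
    simp only [Tm.rename, Tm.app_eval_lam, ht]
    congr 1
    funext τ x
    cases x <;> rfl
  | _ => rfl

theorem Tm.eval_weaken {a τ : Ty Base} (t : Tm S Γ τ) (ρ : Env S Γ) (d : Sem S a) :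
    (t.weaken a).eval v (ρ.cons d) = t.eval v ρ := t.eval_rename v _ _

theorem Tm.eval_subst {τ : Ty Base} (t : Tm S Γ τ) (s : Sub S Γ Δ) (ρ : Env S Δ) :
    (t.subst s).eval v ρ = t.eval v (fun τ x => (s τ x).eval v ρ) := by
  induction t generalizing Δ with
  | app f t hf ht => simp only [Tm.subst, Tm.eval_app, hf, ht]
  | lam t ht =>
    refine Sem.ext fun d => ?_
    simp only [Tm.subst, Tm.app_eval_lam, ht]
    congr 1
    funext τ x
    cases x
    · rfl
    · exact Tm.eval_weaken _ _ _ _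
  | _ => rfl

theorem Conv.eval_eq {τ : Ty Base} {t t' : Tm S Γ τ} (h : Conv t t') (ρ : Env S Γ) :
    t.eval v ρ = t'.eval v ρ := by
  induction h with
  | refl t => rfl
  | symm _ ih => exact (ih ρ).symm
  | trans _ _ ih ih' => exact (ih ρ).trans (ih' ρ)
  | app _ _ ih ih' => rw [Tm.eval_app, ih, ih', Tm.eval_app]
  | lam _ ih => exact Sem.ext fun d => ih _
  | beta t u =>
    rw [Tm.eval_subst, Tm.eval_app, Tm.app_eval_lam]
    congr 1
    funext τ x
    cases x <;> rfl
  | eta t =>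
    refine Sem.ext fun d => ?_
    rw [Tm.app_eval_lam, Tm.eval_app, Tm.eval_weaken]
    rfl

end eval

/-- The interpretation of ground terms. -/
noncomputable def Ground.eval (v : Val S) {τ : Ty Base} (t : Ground S τ) : Sem S τ :=
  Quotient.lift (fun t : Tm S [] τ => t.eval v .nil) (fun _ _ h => Conv.eval_eq v h _) t

theorem Tm.eval_toGround (v : Val S) {τ : Ty Base} (t : Tm S [] τ) :
    t.toGround.eval v = t.eval v .nil := rfl

theorem Ground.eval_app (v : Val S) {a b : Ty Base} (f : Ground S (.arr a b)) (t : Ground S a) :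
    (f.app t).eval v = (f.eval v).app (t.eval v) := by
  induction f, t using Quotient.inductionOn₂
  rfl

theorem Ground.term_eval (v : Val S) {τ : Ty Base} (t : Ground S τ) : (t.eval v).term = t := by
  induction t using Quotient.inductionOn with
  | _ t =>
  refine (t.term_eval v .nil).trans (congrArg Tm.toGround ?_)
  rw [Tm.subst_eq_inst]
  convert t.inst_nom_var using 2
  funext τ x
  cases x

/-- Evaluation at first-order types is thus independent of the valuation, and the default elements
used in `Sem.quantifier` are the values of the instantiating terms. -/
theorem Ground.eval_of_firstOrder (v : Val S) {τ : Ty Base} (hτ : τ.FirstOrder)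
    (t : Ground S τ) : t.eval v = .default t :=
  Sem.eq_of_firstOrder hτ (by rw [Ground.term_eval, Sem.term_default])

/-- Truth of a formula under a valuation. -/
def Formula.Holds (v : Val S) (A : Formula S) : Prop := (Ground.eval v A).holds

/-- Truth of the application of an element of the model to a tuple of terms. -/
def Sem.holdsAt (v : Val S) : {w : Ty Base} → Sem S w → Spine S w → Prop
  | _, d, .nil => d.holds
  | _, d, .cons t ts => (d.app (t.eval v)).holdsAt v ts

theorem Ground.holds_apps (v : Val S) {w : Ty Base} (f : Ground S w) (ts : Spine S w) :
    Formula.Holds v (f.apps ts) ↔ (f.eval v).holdsAt v ts := by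
  induction ts with
  | nil => rfl
  | cons t ts ih => rw [Ground.apps, ih, Ground.eval_app]; rfl

theorem Sem.holdsAt_ofTerm (v : Val S) {w : Ty Base} (g : Ground S w) (P : Spine S w → Prop)
    (ts : Spine S w) : (Sem.ofTerm g P).holdsAt v ts ↔ P ts := by
  induction ts with
  | nil => rfl
  | cons t ts ih =>
    rw [Sem.holdsAt, Sem.app_ofTerm, ih, Ground.term_eval]

namespace Formula
variable (v : Val S)

theorem holds_atom {w : Ty Base} (p : S.Con w) (ts : Spine S w) :
    Holds v (atom p ts) ↔ v w p ts := by
  rw [atom, Ground.holds_apps, Tm.eval_toGround, Tm.eval_con, Sem.holdsAt_ofTerm]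

theorem holds_bot : ¬ Holds v (bot : Formula S) := id

theorem holds_top : Holds v (top : Formula S) := trivial

theorem holds_and (A B : Formula S) : Holds v (A.and B) ↔ Holds v A ∧ Holds v B := by
  rw [Holds, and, Ground.eval_app, Ground.eval_app]; rfl

theorem holds_or (A B : Formula S) : Holds v (A.or B) ↔ Holds v A ∨ Holds v B := by
  rw [Holds, or, Ground.eval_app, Ground.eval_app]; rfl

theorem holds_imp (A B : Formula S) : Holds v (A.imp B) ↔ (Holds v A → Holds v B) := by
  rw [Holds, imp, Ground.eval_app, Ground.eval_app]; rfl

variable {α : Ty Base} (h : α.FirstOrder) (F : Ground S (.arr α .o))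

theorem holds_app_iff (h : α.FirstOrder) (F : Ground S (.arr α .o)) (t : Ground S α) :
    Holds v (F.app t) ↔ ((F.eval v).app (.default t)).holds := by
  rw [Holds, Ground.eval_app, t.eval_of_firstOrder v h]

theorem holds_all : Holds v (all α h F) ↔ ∀ t, Holds v (F.app t) := by
  simp only [holds_app_iff v h]
  rw [Holds, all, Ground.eval_app]; rfl

theorem holds_ex : Holds v (ex α h F) ↔ ∃ t, Holds v (F.app t) := by
  simp only [holds_app_iff v h]
  rw [Holds, ex, Ground.eval_app]; rfl

theorem holds_nab : Holds v (nab α h F) ↔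
    ∀ᶠ k in Filter.cofinite, Holds v (F.app (Tm.nom α k).toGround) := by
  simp only [holds_app_iff v h]
  rw [Holds, nab, Ground.eval_app]; rfl

end Formula

/-- Atoms determine their predicate and their arguments. -/
theorem atom_injective {w w' : Ty Base} {p : S.Con w} {p' : S.Con w'} {ts : Spine S w}
    {ts' : Spine S w'} (h : atom p ts = atom p' ts') :
    (⟨w, p, ts⟩ : Σ w : Ty Base, S.Con w × Spine S w) = ⟨w', p', ts'⟩ := by
  -- This valuation makes a single atom true, so truth of the second atom is the required equality.
  let v : Val S := fun u q us => (⟨w, p, ts⟩ : Σ w : Ty Base, S.Con w × Spine S w) = ⟨u, q, us⟩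
  have h' : Formula.Holds v (atom p ts) := (Formula.holds_atom v p ts).2 rfl
  rw [h] at h'
  exact (Formula.holds_atom v p' ts').1 h'

/-! ## Logical relations on the model -/

/-- The logical relation generated by a permutation of the nominal constants and the equivalence
of propositions. If `str` holds, the formulas that underlie related propositions have to correspond
to each other under the permutation as well. -/
def Sem.Rel (str : Prop) (π : Ty Base → Equiv.Perm ℕ) : {τ : Ty Base} → Sem S τ → Sem S τ → Prop
  | .base _, d, e => e.term = d.term.permute π
  | .o, d, e => (str → e.term = d.term.permute π) ∧ (d.holds ↔ e.holds)
  | .arr _ _, f, g => ∀ d e, Rel str π d e → Rel str π (f.app d) (g.app e)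

namespace Sem
variable {str : Prop} {π : Ty Base → Equiv.Perm ℕ}

/-- By extensionality it is enough to compare the terms on arguments; every ground argument is the
permuted term of a pair of related default elements. -/
theorem Rel.term_arr {a b : Ty Base} {f g : Sem S (.arr a b)}
    (ha : ∀ t : Ground S a, Rel str π (default t) (default (t.permute π)))
    (hb : ∀ d e : Sem S b, Rel str π d e → e.term = d.term.permute π) (h : Rel str π f g) :
    g.term = f.term.permute π := by
  refine Ground.ext_app fun t => ?_
  have := hb _ _ (h _ _ (ha (t.permute π⁻¹)))
  rwa [term_app, term_app, term_default, term_default, Ground.permute_app,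
    Ground.permute_permute_inv] at this

theorem Rel.ofTerm_arr {a b : Ty Base} {g : Ground S (.arr a b)} {P P' : Spine S (.arr a b) → Prop}
    (ha : ∀ d e : Sem S a, Rel str π d e → e.term = d.term.permute π)
    (hb : ∀ (g : Ground S b) (P P' : Spine S b → Prop), (∀ ts, P ts ↔ P' (ts.permute π)) →
      Rel str π (ofTerm g P) (ofTerm (g.permute π) P'))
    (h : ∀ ts, P ts ↔ P' (ts.permute π)) :
    Rel str π (ofTerm g P) (ofTerm (g.permute π) P') := by
  intro d e hde
  rw [app_ofTerm, app_ofTerm, ha _ _ hde, ← Ground.permute_app]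
  exact hb _ _ _ fun ts => h _

/-- The two claims are proved together because at a function type each of them uses the other one at
the argument type. -/
theorem rel_firstOrder_aux {τ : Ty Base} (hτ : τ.FirstOrder ∨ str) :
    (∀ d e : Sem S τ, Rel str π d e → e.term = d.term.permute π) ∧
      ∀ (g : Ground S τ) (P P' : Spine S τ → Prop), (∀ ts, P ts ↔ P' (ts.permute π)) →
        Rel str π (ofTerm g P) (ofTerm (g.permute π) P') := by
  induction τ with
  | base b => exact ⟨fun d e h => h, fun g P P' _ => rfl⟩
  | o =>
    have h : str := hτ.resolve_left id
    exact ⟨fun d e hde => hde.1 h, fun g P P' hP => ⟨fun _ => rfl, hP .nil⟩⟩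
  | arr a b iha ihb =>
    have ha := iha (hτ.imp_left And.left)
    have hb := ihb (hτ.imp_left And.right)
    exact ⟨fun d e => Rel.term_arr (fun t => ha.2 t _ _ fun _ => Iff.rfl) hb.1,
      fun g P P' => Rel.ofTerm_arr ha.1 hb.2⟩

theorem Rel.term {τ : Ty Base} (hτ : τ.FirstOrder ∨ str) {d e : Sem S τ} (h : Rel str π d e) :
    e.term = d.term.permute π := (rel_firstOrder_aux hτ).1 _ _ h

theorem Rel.default {τ : Ty Base} (hτ : τ.FirstOrder ∨ str) (t : Ground S τ) :
    Rel str π (default t) (default (t.permute π)) :=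
  (rel_firstOrder_aux hτ).2 _ _ _ fun _ => Iff.rfl

/-- For a propositional type the arguments are first-order, so their terms correspond even if the
relation ignores the formulas underlying propositions. -/
theorem Rel.ofTerm {τ : Ty Base} (hτ : τ.FirstOrder ∨ τ.Propositional) (g : Ground S τ)
    {P P' : Spine S τ → Prop} (h : ∀ ts, P ts ↔ P' (ts.permute π)) :
    Rel str π (ofTerm g P) (ofTerm (g.permute π) P') := by
  rcases hτ with hτ | hτ
  · exact (rel_firstOrder_aux (.inl hτ)).2 _ _ _ h
  · induction τ with
    | base b => exact hτ.elim
    | o => exact ⟨fun _ => rfl, h .nil⟩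
    | arr a b _ hb =>
      exact Rel.ofTerm_arr (fun d e => Rel.term (.inl hτ.1)) (fun g P P' hP => hb g hP hτ.2) h

theorem Rel.connective (c : LogCon (.arr .o (.arr .o .o) : Ty Base)) {op : Prop → Prop → Prop} :
    Rel str π (Sem.connective (S := S) c op) (Sem.connective c op) := by
  intro d e h d' e' h'
  refine ⟨fun hs => ?_, ?_⟩
  · change ((Tm.log c).toGround.app e.term).app e'.term = _
    change _ = Ground.permute π (((Tm.log c).toGround.app d.term).app d'.term)
    rw [h.1 hs, h'.1 hs, Ground.permute_app, Ground.permute_app]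
    rfl
  · change op _ _ ↔ op _ _
    rw [propext h.2, propext h'.2]

theorem Rel.quantifier {a : Ty Base} (ha : a.FirstOrder) (c : LogCon (.arr (.arr a .o) .o))
    {op : (Ground S a → Prop) → Prop}
    (hop : ∀ P Q : Ground S a → Prop, (∀ t, P t ↔ Q (t.permute π)) → (op P ↔ op Q)) :
    Rel str π (Sem.quantifier c op) (Sem.quantifier c op) := by
  intro F G h
  refine ⟨fun hs => ?_, hop _ _ fun t => (h _ _ (Rel.default (.inl ha) t)).2⟩
  change (Tm.log c).toGround.app G.term = _
  rw [Rel.term (.inr hs) h]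
  exact (Ground.permute_app _ (Tm.log c).toGround _).symm

theorem Rel.log {τ : Ty Base} (c : LogCon τ) :
    Rel str π (Sem.log S c) (Sem.log S c) := by
  cases c with
  | bot => exact ⟨fun _ => rfl, Iff.rfl⟩
  | top => exact ⟨fun _ => rfl, Iff.rfl⟩
  | and => exact Rel.connective _
  | or => exact Rel.connective _
  | imp => exact Rel.connective _
  | all a h =>
    refine Rel.quantifier h _ fun P Q hPQ => ⟨fun hP t => ?_, fun hQ t => (hPQ t).2 (hQ _)⟩
    have := (hPQ (t.permute π⁻¹)).1 (hP _)
    rwa [Ground.permute_permute_inv] at this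
  | ex a h =>
    refine Rel.quantifier h _ fun P Q hPQ =>
      ⟨fun ⟨t, ht⟩ => ⟨_, (hPQ t).1 ht⟩, fun ⟨t, ht⟩ => ⟨t.permute π⁻¹, (hPQ _).2 ?_⟩⟩
    rwa [Ground.permute_permute_inv]
  | nab a h =>
    refine Rel.quantifier h _ fun P Q hPQ => ?_
    have e : ∀ k, P (Tm.nom a k).toGround ↔ Q (Tm.nom a (π a k)).toGround := fun k => hPQ _
    simp only [e]
    constructor
    · intro hP
      have := (π a)⁻¹.injective.tendsto_cofinite.eventually hP
      simpa using this
    · exact fun hQ => (π a).injective.tendsto_cofinite.eventually hQ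

/-- The fundamental lemma of logical relations. -/
theorem Rel.eval {v v' : Val S} {Γ : List (Ty Base)} {τ : Ty Base} (t : Tm S Γ τ)
    (hc : ∀ (w : Ty Base) (c : S.Con w), t.OccursCon c → ∀ ts, v w c ts ↔ v' w c (ts.permute π))
    (hn : ∀ σ k, t.OccursNom σ k → str) {ρ ρ' : Env S Γ}
    (hρ : ∀ τ x, Rel str π (ρ τ x) (ρ' τ x)) :
    Rel str π (t.eval v ρ) ((t.permute π).eval v' ρ') := by
  induction t with
  | var x => exact hρ _ x
  | con c => exact Rel.ofTerm (S.typed _ ⟨c⟩) _ (hc _ c rfl)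
  | log c => exact Rel.log c
  -- Nominals exist in all types. Without `str`, one of type `o → b` would send equivalent but
  -- different formulas to different terms.
  | nom τ k => exact Rel.default (.inr (hn τ k ⟨rfl, rfl⟩)) _
  | app f t hf ht =>
    exact hf (fun w c h => hc w c (.inl h)) (fun σ k h => hn σ k (.inl h)) hρ _ _
      (ht (fun w c h => hc w c (.inr h)) (fun σ k h => hn σ k (.inr h)) hρ)
  | lam t ht =>
    intro d e hde
    refine ht hc hn fun τ x => ?_
    cases x
    · exact hde
    · exact hρ _ _

end Sem

-- Permutation of valuations and replacement of a predicate

/-- The action of a permutation of the nominal constants on valuations. -/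
def Val.comap (π : Ty Base → Equiv.Perm ℕ) (v : Val S) : Val S :=
  fun w p ts => v w p (ts.permute π)

theorem Formula.holds_permute (π : Ty Base → Equiv.Perm ℕ) (v : Val S) (A : Formula S) :
    Holds v (Ground.permute π A) ↔ Holds (v.comap π) A := by
  induction A using Quotient.inductionOn with
  | _ t =>
  exact (Sem.Rel.eval (str := True) (v := v.comap π) (v' := v) t (fun _ _ _ _ => Iff.rfl)
    (fun _ _ _ => trivial) (ρ := .nil) (ρ' := .nil) fun τ x => nomatch x).2.symm

/-- Modification of a valuation at one predicate. -/
def Val.update (v : Val S) {w : Ty Base} (p : S.Con w) (X : Spine S w → Prop) : Val S :=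
  fun w' q us =>
    (∃ ts, (⟨w', q, us⟩ : Σ w : Ty Base, S.Con w × Spine S w) = ⟨w, p, ts⟩ ∧ X ts) ∨
      ((⟨w', q⟩ : Σ w : Ty Base, S.Con w) ≠ ⟨w, p⟩ ∧ v w' q us)

theorem Val.update_self (v : Val S) {w : Ty Base} (p : S.Con w) (X : Spine S w → Prop)
    (ts : Spine S w) : v.update p X w p ts ↔ X ts := by
  simp [Val.update]

theorem Val.update_of_ne (v : Val S) {w w' : Ty Base} (p : S.Con w) (X : Spine S w → Prop)
    {q : S.Con w'} (h : (⟨w', q⟩ : Σ w : Ty Base, S.Con w) ≠ ⟨w, p⟩) (us : Spine S w') :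
    v.update p X w' q us ↔ v w' q us := by
  refine ⟨?_, fun hv => .inr ⟨h, hv⟩⟩
  rintro (⟨ts, e, -⟩ | ⟨-, hv⟩)
  · cases e
    exact (h rfl).elim
  · exact hv

/-- At propositional types the relation without syntactic component is extensional equivalence on
ground arguments. In particular a predicate constant can be related to an unrelated term with the
same extension. -/
theorem Sem.rel_of_holdsAt {v v' : Val S} {w : Ty Base} (hw : w.Propositional) {d e : Sem S w}
    (h : ∀ ts, d.holdsAt v ts ↔ e.holdsAt v' ts) : Rel False 1 d e := by
  induction w with
  | base b => exact hw.elim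
  | o => exact ⟨False.elim, h .nil⟩
  | arr a b _ hb =>
    intro x y hxy
    have hy : y = x := eq_of_firstOrder hw.1 (by rw [hxy.term (.inl hw.1), Ground.permute_one])
    subst hy
    refine hb hw.2 fun ts => ?_
    have := h (.cons y.term ts)
    rwa [holdsAt, holdsAt, Ground.eval_of_firstOrder _ hw.1, Ground.eval_of_firstOrder _ hw.1,
      eq_of_firstOrder hw.1 (term_default y.term)] at this

theorem Sem.Rel.holdsAt {v v' : Val S} {w : Ty Base} (hw : w.Propositional) {d e : Sem S w}
    (h : Rel False 1 d e) (ts : Spine S w) : d.holdsAt v ts ↔ e.holdsAt v' ts := by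
  induction ts with
  | nil => exact h.2
  | cons t ts ih =>
    rw [Sem.holdsAt, Sem.holdsAt]
    refine ih hw.2 (h _ _ ?_)
    rw [Ground.eval_of_firstOrder _ hw.1, Ground.eval_of_firstOrder _ hw.1]
    have := Rel.default (str := False) (π := 1) (.inl hw.1) t
    rwa [Ground.permute_one] at this

/-- The operator contains neither nominals nor the predicate, so by the fundamental lemma its values
under the two valuations are related, and it maps the predicate and `T`, which have equal
extensions, to predicates with equal extensions. -/
theorem IndClause.Valid.holds_unfold {d : IndClause S} (hd : d.Valid) (v : Val S)
    (T : Ground S d.type) {X : Spine S d.type → Prop}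
    (hX : ∀ ts, X ts ↔ Formula.Holds v (T.apps ts)) (ts : Spine S d.type) :
    Formula.Holds (v.update d.pred X) ((d.unfold d.predTerm).apps ts) ↔
      Formula.Holds v ((d.unfold T).apps ts) := by
  rw [Ground.holds_apps, Ground.holds_apps]
  refine Sem.Rel.holdsAt hd.propositional ?_ ts
  rw [IndClause.unfold, IndClause.unfold, Ground.eval_app, Ground.eval_app]
  have hop : Sem.Rel False 1 (d.op.eval (v.update d.pred X) .nil)
      ((d.op.permute 1).eval v .nil) := by
    refine Sem.Rel.eval d.op (fun w c hc us => ?_) hd.nominalFree (fun τ x => nomatch x)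
    rw [us.permute_one]
    refine Val.update_of_ne v d.pred X (fun h => hd.not_occurs ?_) us
    cases h
    exact hc
  rw [d.op.permute_eq_self fun σ k _ => rfl] at hop
  refine hop _ _ (Sem.rel_of_holdsAt (v := v.update d.pred X) (v' := v)
    hd.propositional fun us => ?_)
  rw [← Ground.holds_apps, ← Ground.holds_apps, ← hX us]
  exact (Formula.holds_atom _ d.pred us).trans (Val.update_self _ _ _ _)

/-! ## Levels -/

/-- `LevelLE l C a`: the level of the formula `C` is at most `a`, given the levels `l` of atoms. -/
inductive LevelLE (l : Formula S → Ordinal.{u}) : Formula S → Ordinal.{u} → Prop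
  | atom {w : Ty Base} (p : S.Con w) (ts : Spine S w) {a : Ordinal.{u}} :
      l (atom p ts) ≤ a → LevelLE l (atom p ts) a
  | bot {a : Ordinal.{u}} : LevelLE l Formula.bot a
  | top {a : Ordinal.{u}} : LevelLE l Formula.top a
  | and {A B : Formula S} {a : Ordinal.{u}} :
      LevelLE l A a → LevelLE l B a → LevelLE l (A.and B) a
  | or {A B : Formula S} {a : Ordinal.{u}} :
      LevelLE l A a → LevelLE l B a → LevelLE l (A.or B) a
  | imp {A B : Formula S} {a b : Ordinal.{u}} :
      b < a → LevelLE l A b → LevelLE l B a → LevelLE l (A.imp B) a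
  | all {α : Ty Base} (h : α.FirstOrder) {F : Ground S (.arr α .o)} {a : Ordinal.{u}} :
      (∀ t, LevelLE l (F.app t) a) → LevelLE l (Formula.all α h F) a
  | ex {α : Ty Base} (h : α.FirstOrder) {F : Ground S (.arr α .o)} {a : Ordinal.{u}} :
      (∀ t, LevelLE l (F.app t) a) → LevelLE l (Formula.ex α h F) a
  | nab {α : Ty Base} (h : α.FirstOrder) {F : Ground S (.arr α .o)} {a : Ordinal.{u}}
      {s : Set ℕ} : s.Finite →
      (∀ k ∉ s, LevelLE l (F.app (Tm.nom α k).toGround) a) → LevelLE l (Formula.nab α h F) a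

theorem Ground.finite_not_fresh {τ : Ty Base} (t : Ground S τ) (σ : Ty Base) :
    {k | ¬ t.Fresh σ k}.Finite := by
  induction t using Quotient.inductionOn with
  | _ r =>
  refine (r.finite_occursNom σ).subset fun k hk => ?_
  by_contra h
  exact hk ⟨r, rfl, h⟩

/-- Upper bounds are easier to handle than exact levels: they survive a decrease of the levels of
atoms and need no suprema. For `∇`, the finitely many nominals that are not fresh form the
exceptional set. -/
theorem HasLevel.levelLE {l : Formula S → Ordinal.{u}} {C : Formula S} {a b : Ordinal.{u}}
    (h : HasLevel l C a) (hab : a ≤ b) : LevelLE l C b := by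
  induction h generalizing b with
  | atom hA =>
    obtain ⟨w, p, ts, rfl⟩ := hA
    exact .atom p ts hab
  | bot => exact .bot
  | top => exact .top
  | and _ _ ihA ihB =>
    exact .and (ihA ((le_max_left _ _).trans hab)) (ihB ((le_max_right _ _).trans hab))
  | or _ _ ihA ihB =>
    exact .or (ihA ((le_max_left _ _).trans hab)) (ihB ((le_max_right _ _).trans hab))
  | @imp A B a' _ _ _ ihA ihB =>
    have h : a' + 1 ≤ b := (le_max_left _ _).trans hab
    exact .imp (Order.add_one_le_iff.1 h) (ihA le_rfl) (ihB ((le_max_right _ _).trans hab))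
  | all h _ ih => exact .all h fun t => ih t ((Ordinal.le_iSup _ t).trans hab)
  | ex h _ ih => exact .ex h fun t => ih t ((Ordinal.le_iSup _ t).trans hab)
  | @nab α h F _ _ ih =>
    exact .nab h (F.finite_not_fresh α) fun k hk => ih k (not_not.1 hk) hab

theorem LevelLE.mono {l l' : Formula S → Ordinal.{u}} (hl : ∀ A, l' A ≤ l A) {C : Formula S}
    {a : Ordinal.{u}} (h : LevelLE l C a) : LevelLE l' C a := by
  induction h with
  | atom p ts h => exact .atom p ts ((hl _).trans h)
  | bot => exact .bot
  | top => exact .top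
  | and _ _ ihA ihB => exact .and ihA ihB
  | or _ _ ihA ihB => exact .or ihA ihB
  | imp h _ _ ihA ihB => exact .imp h ihA ihB
  | all h _ ih => exact .all h ih
  | ex h _ ih => exact .ex h ih
  | nab h hs _ ih => exact .nab h hs ih

theorem LevelLE.permute {l : Formula S → Ordinal.{u}} (π : Ty Base → Equiv.Perm ℕ)
    (hl : ∀ A, l (Ground.permute π A) = l A) {C : Formula S}
    {a : Ordinal.{u}} (h : LevelLE l C a) : LevelLE l (Ground.permute π C) a := by
  have app_permute : ∀ {α : Ty Base} (F : Ground S (.arr α .o)) (t : Ground S α),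
      Ground.permute π (F.app (t.permute π⁻¹)) = (F.permute π).app t := fun F t => by
    rw [Ground.permute_app, Ground.permute_permute_inv]
  induction h with
  | atom p ts h =>
    rw [← hl, atom_permute] at h
    rw [atom_permute]
    exact .atom p _ h
  | bot => exact .bot
  | top => exact .top
  | and _ _ ihA ihB =>
    rw [Formula.and, Ground.permute_app, Ground.permute_app]
    exact .and ihA ihB
  | or _ _ ihA ihB =>
    rw [Formula.or, Ground.permute_app, Ground.permute_app]
    exact .or ihA ihB
  | imp h _ _ ihA ihB =>
    rw [Formula.imp, Ground.permute_app, Ground.permute_app]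
    exact .imp h ihA ihB
  | all h _ ih =>
    rw [Formula.all, Ground.permute_app]
    exact .all h fun t => app_permute _ t ▸ ih _
  | ex h _ ih =>
    rw [Formula.ex, Ground.permute_app]
    exact .ex h fun t => app_permute _ t ▸ ih _
  | @nab α h F a s hs _ ih =>
    rw [Formula.nab, Ground.permute_app]
    refine .nab h (hs.image (π α)) fun k hk => ?_
    have := ih ((π α)⁻¹ k) fun h' => hk ⟨_, h', by simp⟩
    rwa [show (Tm.nom α ((π α)⁻¹ k) : Tm S [] α).toGround = (Tm.nom α k).toGround.permute π⁻¹
      from rfl, app_permute] at this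

/-- Formulas of level at most `a` depend monotonically on the atoms of level `a` and arbitrarily on
the atoms of smaller level. -/
theorem LevelLE.holds_mono {l : Formula S → Ordinal.{u}} {C : Formula S} {a : Ordinal.{u}}
    (h : LevelLE l C a) {v v' : Val S}
    (hlt : ∀ w (p : S.Con w) ts, l (LD.atom p ts) < a → (v w p ts ↔ v' w p ts))
    (hle : ∀ w (p : S.Con w) ts, l (LD.atom p ts) = a → v w p ts → v' w p ts)
    (hC : C.Holds v) : C.Holds v' := by
  induction h generalizing v v' with
  | atom p ts h =>
    rw [Formula.holds_atom] at hC ⊢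
    rcases h.lt_or_eq with h | h
    · exact (hlt _ p ts h).1 hC
    · exact hle _ p ts h hC
  | bot => exact (Formula.holds_bot v hC).elim
  | top => exact Formula.holds_top v'
  | and _ _ ihA ihB =>
    rw [Formula.holds_and] at hC ⊢
    exact ⟨ihA hlt hle hC.1, ihB hlt hle hC.2⟩
  | or _ _ ihA ihB =>
    rw [Formula.holds_or] at hC ⊢
    exact hC.imp (ihA hlt hle) (ihB hlt hle)
  | imp h _ _ ihA ihB =>
    -- The antecedent has level below `a`, so it depends only on atoms at which the valuations
    -- agree, and the induction hypothesis applies with their roles exchanged.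
    rw [Formula.holds_imp] at hC ⊢
    exact fun hA => ihB hlt hle (hC (ihA (fun w p ts h' => (hlt w p ts (h'.trans h)).symm)
      (fun w p ts h' => (hlt w p ts (h'.trans_lt h)).2) hA))
  | all h _ ih =>
    rw [Formula.holds_all] at hC ⊢
    exact fun t => ih t hlt hle (hC t)
  | ex h _ ih =>
    rw [Formula.holds_ex] at hC ⊢
    exact hC.imp fun t => ih t hlt hle
  | nab h hs _ ih =>
    rw [Formula.holds_nab] at hC ⊢
    filter_upwards [hC, hs.compl_mem_cofinite] with k hk hks
    exact ih k hks hlt hle hk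

/-- The least level of a formula up to permutations of the nominal constants. -/
noncomputable def minLevel (lvl : Formula S → Ordinal.{u}) (A : Formula S) : Ordinal.{u} :=
  ⨅ π : Ty Base → Equiv.Perm ℕ, lvl (Ground.permute π A)

theorem minLevel_le_permute (lvl : Formula S → Ordinal.{u}) (A : Formula S)
    (π : Ty Base → Equiv.Perm ℕ) : minLevel lvl A ≤ lvl (Ground.permute π A) :=
  ciInf_le' _ π

theorem minLevel_le (lvl : Formula S → Ordinal.{u}) (A : Formula S) :
    minLevel lvl A ≤ lvl A := by
  simpa only [Ground.permute_one] using minLevel_le_permute lvl A 1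

theorem exists_minLevel_eq (lvl : Formula S → Ordinal.{u}) (A : Formula S) :
    ∃ π : Ty Base → Equiv.Perm ℕ, lvl (Ground.permute π A) = minLevel lvl A :=
  ciInf_mem fun π : Ty Base → Equiv.Perm ℕ => lvl (Ground.permute π A)

theorem minLevel_permute (lvl : Formula S → Ordinal.{u}) (π : Ty Base → Equiv.Perm ℕ)
    (A : Formula S) : minLevel lvl (Ground.permute π A) = minLevel lvl A := by
  have h : ∀ (ρ : Ty Base → Equiv.Perm ℕ) (B : Formula S),
      minLevel lvl (Ground.permute ρ B) ≤ minLevel lvl B := by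
    intro ρ B
    obtain ⟨σ, hσ⟩ := exists_minLevel_eq lvl B
    rw [← hσ]
    have := minLevel_le_permute lvl (Ground.permute ρ B) (σ * ρ⁻¹)
    rwa [Ground.permute_mul, Ground.permute_inv_permute] at this
  refine (h π A).antisymm ?_
  have := h π⁻¹ (Ground.permute π A)
  rwa [Ground.permute_inv_permute] at this

/-! ## Unfolding of atoms -/

variable (D : Set (Clause S)) (I : Set (IndClause S))

/-- `B` is the body of a ground instance with head `A` of a clause of `D` or of `I`. -/
def Unfolds (A B : Formula S) : Prop :=
  (∃ c ∈ D, c.Defn A B) ∨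
    ∃ d ∈ I, ∃ ts : Spine S d.type, A = atom d.pred ts ∧ B = (d.unfold d.predTerm).apps ts

theorem Tm.HeadedBy.subst_apps {w : Ty Base} {p : S.Con w} {Γ : List (Ty Base)} {τ : Ty Base}
    {t : Tm S Γ τ} (h : t.HeadedBy p) (ρ : Sub S Γ []) (ts : Spine S τ) :
    ∃ us, (t.subst ρ).toGround.apps ts = atom p us := by
  induction h with
  | con => exact ⟨ts, rfl⟩
  | app t _ ih => exact ih (.cons (t.subst ρ).toGround ts)

theorem Clause.Valid.exists_atom {c : Clause S} (hc : c.Valid) {A B : Formula S}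
    (h : c.Defn A B) :
    ∃ (w : Ty Base) (p : S.Con w) (ts : Spine S w), c.head.HeadedBy p ∧ A = atom p ts := by
  obtain ⟨w, p, hp⟩ := hc.atomic
  obtain ⟨ρ, rfl, -⟩ := h
  obtain ⟨ts, hts⟩ := hp.subst_apps ρ .nil
  exact ⟨w, p, ts, hp, hts⟩

variable {D I}

/-- Heads, bodies and operators have empty support, so a permutation acts only on the instantiating
terms. -/
theorem Unfolds.permute (hv : ValidDefs D I) (π : Ty Base → Equiv.Perm ℕ) {A B : Formula S}
    (h : Unfolds D I A B) : Unfolds D I (Ground.permute π A) (Ground.permute π B) := by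
  rcases h with ⟨c, hc, ρ, rfl, rfl⟩ | ⟨d, hd, ts, rfl, rfl⟩
  · refine .inl ⟨c, hc, fun τ x => (ρ τ x).permute π, ?_, ?_⟩
    · rw [← (hv.clause_valid c hc).head_nominalFree.subst_permute, Tm.toGround_permute]
    · rw [← (hv.clause_valid c hc).body_nominalFree.subst_permute, Tm.toGround_permute]
  · refine .inr ⟨d, hd, ts.permute π, atom_permute _ _ _, ?_⟩
    rw [Ground.permute_apps, IndClause.unfold, Ground.permute_app, ← Tm.toGround_permute,
      d.op.permute_eq_self fun σ k hk => ((hv.ind_valid d hd).nominalFree σ k hk).elim]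
    rfl

theorem Unfolds.of_ind (hv : ValidDefs D I) {d : IndClause S} (hd : d ∈ I)
    {ts : Spine S d.type} {B : Formula S} (h : Unfolds D I (atom d.pred ts) B) :
    B = (d.unfold d.predTerm).apps ts := by
  rcases h with ⟨c, hc, h⟩ | ⟨e, he, us, h, rfl⟩
  · obtain ⟨w, p, us, hp, e⟩ := (hv.clause_valid c hc).exists_atom h
    have e' := atom_injective e
    rcases d with ⟨w', p', op⟩
    cases e'
    exact (hv.ind_not_defined _ hd ⟨c, hc, hp⟩).elim
  · have h' := atom_injective h
    have e' : d = e := hv.ind_unique d hd e he (by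
      rw [Sigma.mk.injEq] at h' ⊢
      refine ⟨h'.1, ?_⟩
      rcases d with ⟨w, p, op⟩
      rcases e with ⟨w', p', op'⟩
      obtain ⟨rfl, h'⟩ := h'
      exact heq_of_eq (congrArg Prod.fst (eq_of_heq h')))
    subst e'
    cases h'
    rfl

theorem Unfolds.of_nonInductiveAtom {A B : Formula S} (hA : NonInductiveAtom I A)
    (h : Unfolds D I A B) : ∃ c ∈ D, c.Defn A B := by
  rcases h with h | ⟨d, hd, us, rfl, -⟩
  · exact h
  · obtain ⟨w, p, ts, e, hp⟩ := hA
    have e' := atom_injective e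
    have hp := hp d hd
    rcases d with ⟨w', p', op⟩
    cases e'
    exact (hp rfl).elim

theorem Unfolds.exists_atom (hv : ValidDefs D I) {A B : Formula S} (h : Unfolds D I A B) :
    ∃ (w : Ty Base) (p : S.Con w) (ts : Spine S w), A = atom p ts := by
  rcases h with ⟨c, hc, h⟩ | ⟨d, hd, us, rfl, -⟩
  · obtain ⟨w, p, ts, -, h⟩ := (hv.clause_valid c hc).exists_atom h
    exact ⟨w, p, ts, h⟩
  · exact ⟨_, _, us, rfl⟩

theorem Unfolds.levelLE (hv : ValidDefs D I) {lvl : Formula S → Ordinal.{u}}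
    (hD : WeaklyStratified lvl D) (hI : StrictlyStratified lvl I) {A B : Formula S}
    (h : Unfolds D I A B) : LevelLE (minLevel lvl) B (minLevel lvl A) := by
  have key : ∀ {A B : Formula S}, Unfolds D I A B → LevelLE (minLevel lvl) B (lvl A) := by
    intro A B h
    refine LevelLE.mono (minLevel_le lvl) ?_
    rcases h with ⟨c, hc, h⟩ | ⟨d, hd, ts, rfl, rfl⟩
    · obtain ⟨b, hb, hle⟩ := hD c hc A B h
      exact hb.levelLE hle
    · obtain ⟨b, hb, hle⟩ := hI.weak d hd ts
      exact hb.levelLE hle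
  -- Stratification is applied at the permuted copy of `A` of least level, and the bound is carried
  -- back by the inverse permutation.
  obtain ⟨π, hπ⟩ := exists_minLevel_eq lvl A
  have := (key (h.permute hv π)).permute π⁻¹ (minLevel_permute lvl _)
  rwa [hπ, Ground.permute_inv_permute] at this

theorem StrictlyStratified.minLevel_eq {lvl : Formula S → Ordinal.{u}}
    (hI : StrictlyStratified lvl I) {d : IndClause S} (hd : d ∈ I) (ts us : Spine S d.type) :
    minLevel lvl (atom d.pred ts) = minLevel lvl (atom d.pred us) := by
  simp only [minLevel, atom_permute]
  exact congrArg iInf (funext fun π => hI.const d hd _ _)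

/-! ## The stratified least model -/

/-- The valuation that agrees with `v` at the atoms of level less than `a` and with `v'` at the
others. -/
def Val.below (l : Formula S → Ordinal.{u}) (a : Ordinal.{u}) (v v' : Val S) : Val S :=
  fun w p ts => (l (atom p ts) < a ∧ v w p ts) ∨ (¬ l (atom p ts) < a ∧ v' w p ts)

theorem Val.below_of_lt {l : Formula S → Ordinal.{u}} {a : Ordinal.{u}} (v v' : Val S)
    {w : Ty Base} {p : S.Con w} {ts : Spine S w} (h : l (atom p ts) < a) :
    Val.below l a v v' w p ts ↔ v w p ts := by
  simp [Val.below, h]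

theorem Val.below_of_eq {l : Formula S → Ordinal.{u}} {a : Ordinal.{u}} (v v' : Val S)
    {w : Ty Base} {p : S.Con w} {ts : Spine S w} (h : l (atom p ts) = a) :
    Val.below l a v v' w p ts ↔ v' w p ts := by
  simp [Val.below, h]

/-- Closure of `v'` under unfolding of the atoms of level `a`, where the atoms of smaller level are
evaluated by `v`. -/
def Val.Closed (D : Set (Clause S)) (I : Set (IndClause S)) (l : Formula S → Ordinal.{u})
    (a : Ordinal.{u}) (v v' : Val S) : Prop :=
  ∀ w (p : S.Con w) ts B, l (atom p ts) = a → Unfolds D I (atom p ts) B →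
    B.Holds (Val.below l a v v') → v' w p ts

/-- The atoms of level `a` that hold in the stratified least model. -/
def leastStage (D : Set (Clause S)) (I : Set (IndClause S)) (l : Formula S → Ordinal.{u})
    (a : Ordinal.{u}) : Val S := fun w p ts =>
  ∀ v' : Val S, Val.Closed D I l a
    -- The bound variable is the proof of decrease for the recursion. Atoms not below `a` get the
    -- value false here, but `Val.below` never consults it.
    (fun w q us => ∃ _ : l (atom q us) < a, leastStage D I l (l (atom q us)) w q us) v' →
      v' w p ts
termination_by a

/-- The stratified least model of the definitions. -/
def leastModel (D : Set (Clause S)) (I : Set (IndClause S)) (l : Formula S → Ordinal.{u}) : Val S :=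
  fun w p ts => leastStage D I l (l (atom p ts)) w p ts

variable {l : Formula S → Ordinal.{u}}

theorem leastModel_iff {w : Ty Base} (p : S.Con w) (ts : Spine S w) :
    leastModel D I l w p ts ↔
      ∀ v', Val.Closed D I l (l (atom p ts)) (leastModel D I l) v' → v' w p ts := by
  have e : ∀ a v', Val.below l a (fun w q us => ∃ _ : l (atom q us) < a,
      leastStage D I l (l (atom q us)) w q us) v' = Val.below l a (leastModel D I l) v' := by
    intro a v'
    funext w q us
    simp only [Val.below, leastModel]
    grind
  rw [leastModel, leastStage]
  simp only [Val.Closed, e]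

/-- The first half of the Knaster–Tarski argument: the model lies inside every closed valuation at
this level, so by monotonicity a body true in the model is true there, and closure yields the head.
-/
theorem leastModel_of_unfolds (hl : ∀ A B, Unfolds D I A B → LevelLE l B (l A))
    {w : Ty Base} {p : S.Con w} {ts : Spine S w} {B : Formula S}
    (h : Unfolds D I (atom p ts) B) (hB : B.Holds (leastModel D I l)) :
    leastModel D I l w p ts := by
  rw [leastModel_iff]
  intro v' hv'
  refine hv' w p ts B rfl h ((hl _ _ h).holds_mono (fun w q us h' => ?_) (fun w q us h' hq => ?_) hB)
  · exact (Val.below_of_lt _ _ h').symm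
  · rw [Val.below_of_eq _ _ h']
    rw [leastModel_iff, h'] at hq
    exact hq v' hv'

/-- Induction over the atoms of one level of the stratified least model. -/
theorem leastModel_induction (hl : ∀ A B, Unfolds D I A B → LevelLE l B (l A)) {v' : Val S}
    {w : Ty Base} {p : S.Con w} {ts : Spine S w}
    (hv' : ∀ w (q : S.Con w) us, v' w q us → leastModel D I l w q us)
    (h : ∀ w (q : S.Con w) us B, l (atom q us) = l (atom p ts) → Unfolds D I (atom q us) B →
      B.Holds (leastModel D I l) →
      B.Holds (Val.below l (l (atom p ts)) (leastModel D I l) v') → v' w q us)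
    (hp : leastModel D I l w p ts) : v' w p ts := by
  rw [leastModel_iff] at hp
  -- The hypothesis `h` says that `v'` is closed, up to the additional premise that `B` holds in the
  -- model. That premise follows by monotonicity, as `v'` lies inside the model.
  refine hp v' fun w q us B hq hB hholds => h w q us B hq hB ?_ hholds
  refine (hq ▸ hl _ _ hB).holds_mono (fun w r xs h' => ?_) (fun w r xs h' hr => ?_) hholds
  · exact Val.below_of_lt _ _ h'
  · rw [Val.below_of_eq _ _ h'] at hr
    exact hv' _ _ _ hr

/-- The other half of Knaster–Tarski: the true atoms that have a true unfolding already form a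
closed set. -/
theorem exists_unfolds_of_leastModel (hl : ∀ A B, Unfolds D I A B → LevelLE l B (l A))
    {w : Ty Base} {p : S.Con w} {ts : Spine S w} (h : leastModel D I l w p ts) :
    ∃ B, Unfolds D I (atom p ts) B ∧ B.Holds (leastModel D I l) := by
  refine (leastModel_induction hl (v' := fun w q us => leastModel D I l w q us ∧
    ∃ B, Unfolds D I (atom q us) B ∧ B.Holds (leastModel D I l)) (fun _ _ _ h => h.1) ?_ h).2
  exact fun w q us B _ hB hholds _ => ⟨leastModel_of_unfolds hl hB hholds, B, hB, hholds⟩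

/-- Pulling a closed valuation back along a permutation gives a closed valuation, provided that the
model is already invariant at smaller levels; hence the induction on the level. -/
theorem leastModel_permute (hv : ValidDefs D I)
    (hperm : ∀ π A, l (Ground.permute π A) = l A) {w : Ty Base} {p : S.Con w} {ts : Spine S w}
    (π : Ty Base → Equiv.Perm ℕ) (h : leastModel D I l w p ts) :
    leastModel D I l w p (ts.permute π) := by
  generalize ha : l (atom p ts) = a
  induction a using WellFoundedLT.induction generalizing w p ts π with
  | _ a ih =>
  have hperm' : ∀ w (q : S.Con w) us, l (atom q (us.permute π)) = l (atom q us) :=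
    fun w q us => by rw [← atom_permute, hperm]
  rw [leastModel_iff] at h ⊢
  rw [hperm', ha]
  rw [ha] at h
  intro v' hv'
  refine h (v'.comap π) fun w q us B hq hB hholds => ?_
  refine hv' w q (us.permute π) (Ground.permute π B) ((hperm' _ _ _).trans hq) ?_ ?_
  · rw [← atom_permute]
    exact hB.permute hv π
  · rw [Formula.holds_permute]
    convert hholds using 1
    funext w r xs
    simp only [Val.comap, Val.below, hperm']
    refine propext (or_congr_left (and_congr_right fun hr =>
      ⟨fun h' => ?_, fun h' => ih _ hr π h' rfl⟩))
    have := ih _ hr π⁻¹ h' (by rw [hperm'])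
    rwa [Spine.permute_inv_permute] at this

/-- The induction principle of inductively defined predicates. -/
theorem leastModel_ind (hv : ValidDefs D I) (hl : ∀ A B, Unfolds D I A B → LevelLE l B (l A))
    {d : IndClause S} (hd : d ∈ I)
    (hconst : ∀ ts us, l (atom d.pred ts) = l (atom d.pred us)) {X : Spine S d.type → Prop}
    (hX : ∀ ts, ((d.unfold d.predTerm).apps ts).Holds ((leastModel D I l).update d.pred X) → X ts)
    {ts : Spine S d.type} (h : leastModel D I l _ d.pred ts) : X ts := by
  -- The candidate is the model with those atoms of the defined predicate removed whose arguments
  -- fail `X`.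
  refine (leastModel_induction hl (v' := fun w q us => leastModel D I l w q us ∧
    ∀ ts, (⟨w, q, us⟩ : Σ w : Ty Base, S.Con w × Spine S w) = ⟨d.type, d.pred, ts⟩ → X ts)
    (fun _ _ _ h => h.1) ?_ h).2 ts rfl
  intro w q us B hq hB hM hholds
  refine ⟨leastModel_of_unfolds hl hB hM, fun xs e => hX xs ?_⟩
  cases e
  rw [← hB.of_ind hv hd]
  refine (hq ▸ hl _ _ hB).holds_mono (fun w r ys h' => ?_) (fun w r ys h' hr => ?_) hholds
  -- All atoms of the defined predicate share one level, so none lies strictly below it, and the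
  -- update changes nothing there.
  · rw [Val.below_of_lt _ _ h', Val.update_of_ne]
    intro e
    cases e
    exact h'.ne (hconst _ _)
  · rw [Val.below_of_eq _ _ h'] at hr
    by_cases e : (⟨w, r⟩ : Σ w : Ty Base, S.Con w) = ⟨d.type, d.pred⟩
    · cases e
      exact (Val.update_self _ _ _ _).2 (hr.2 _ rfl)
    · exact (Val.update_of_ne _ _ _ e _).2 hr.1

/-! ## Soundness -/

/-- The transposition of the two nominals fixes `F` and exchanges the two instances, and truth is
invariant under it. -/
theorem Formula.holds_of_fresh {v : Val S} (hv : ∀ π : Ty Base → Equiv.Perm ℕ, v.comap π = v)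
    {α : Ty Base} {F : Ground S (.arr α .o)} {j k : ℕ} {r : Tm S [] (.arr α .o)}
    (hr : r.toGround = F) (hj : ¬ r.OccursNom α j) (hk : ¬ r.OccursNom α k)
    (h : Formula.Holds v (F.app (Tm.nom α j).toGround)) :
    Formula.Holds v (F.app (Tm.nom α k).toGround) := by
  classical
  let π : Ty Base → Equiv.Perm ℕ := Pi.mulSingle α (Equiv.swap j k)
  have hα : π α = Equiv.swap j k := Pi.mulSingle_eq_same _ _
  have hF : F.permute π = F := by
    rw [← hr, ← Tm.toGround_permute, r.permute_eq_self]
    intro σ i hi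
    by_cases e : σ = α
    · subst e
      rw [hα]
      exact Equiv.swap_apply_of_ne_of_ne (fun e => hj (e ▸ hi)) (fun e => hk (e ▸ hi))
    · simp [π, Pi.mulSingle_eq_of_ne e]
  have hnom : (Tm.nom α j : Tm S [] α).toGround.permute π = (Tm.nom α k).toGround := by
    rw [← Tm.toGround_permute, Tm.permute, hα, Equiv.swap_apply_left]
  rwa [← hF, ← hnom, ← Ground.permute_app, Formula.holds_permute, hv]

/-- All fresh instances have the same truth value, and all but finitely many nominals are fresh. So
"cofinitely many" agrees with "some fresh one", as the rules for `∇` demand. -/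
theorem Formula.holds_nab_iff_of_fresh {v : Val S}
    (hv : ∀ π : Ty Base → Equiv.Perm ℕ, v.comap π = v) {α : Ty Base} (h : α.FirstOrder)
    {F : Ground S (.arr α .o)} {k : ℕ} (hk : F.Fresh α k) :
    Formula.Holds v (Formula.nab α h F) ↔ Formula.Holds v (F.app (Tm.nom α k).toGround) := by
  obtain ⟨r, hr, hk⟩ := hk
  rw [Formula.holds_nab]
  have hfin : ∀ᶠ j in Filter.cofinite, ¬ r.OccursNom α j :=
    (r.finite_occursNom α).eventually_cofinite_notMem
  constructor
  · intro hF
    obtain ⟨j, hj, hj'⟩ := (hF.and hfin).exists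
    exact Formula.holds_of_fresh hv hr hj' hk hj
  · exact fun hF => hfin.mono fun j hj => Formula.holds_of_fresh hv hr hk hj hF

/-- Soundness of derivations for valuations that are invariant under permutations, closed under
the definitions and minimal at inductively defined predicates. -/
theorem Derivable.sound {v : Val S} (hv : ∀ π : Ty Base → Equiv.Perm ℕ, v.comap π = v)
    (hunfold : ∀ A, (∃ B, Unfolds D I A B ∧ Formula.Holds v B) → Formula.Holds v A)
    (hdef : ∀ A, NonInductiveAtom I A → Formula.Holds v A →
      ∃ c ∈ D, ∃ B, c.Defn A B ∧ Formula.Holds v B)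
    (hind : ∀ d ∈ I, ∀ T : Ground S d.type,
      (∀ ts, Formula.Holds v ((d.unfold T).apps ts) → Formula.Holds v (T.apps ts)) →
      ∀ us, Formula.Holds v (atom d.pred us) → Formula.Holds v (T.apps us))
    {Γ : Multiset (Formula S)} {C : Formula S} (h : Derivable D I Γ C)
    (hΓ : ∀ A ∈ Γ, Formula.Holds v A) : Formula.Holds v C := by
  induction h with
  | botL => exact (Formula.holds_bot v (hΓ _ (Multiset.mem_cons_self _ _))).elim
  | topR => exact Formula.holds_top v
  | impL _ _ ihA ihB =>
    rw [Multiset.forall_mem_cons, Formula.holds_imp] at hΓ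
    exact ihB (Multiset.forall_mem_cons.2 ⟨hΓ.1 (ihA hΓ.2), hΓ.2⟩)
  | impR _ ih =>
    exact (Formula.holds_imp v _ _).2 fun hA => ih (Multiset.forall_mem_cons.2 ⟨hA, hΓ⟩)
  | andL₁ _ ih =>
    rw [Multiset.forall_mem_cons, Formula.holds_and] at hΓ
    exact ih (Multiset.forall_mem_cons.2 ⟨hΓ.1.1, hΓ.2⟩)
  | andL₂ _ ih =>
    rw [Multiset.forall_mem_cons, Formula.holds_and] at hΓ
    exact ih (Multiset.forall_mem_cons.2 ⟨hΓ.1.2, hΓ.2⟩)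
  | andR _ _ ihA ihB => exact (Formula.holds_and v _ _).2 ⟨ihA hΓ, ihB hΓ⟩
  | orL _ _ ihA ihB =>
    rw [Multiset.forall_mem_cons, Formula.holds_or] at hΓ
    rcases hΓ with ⟨hA | hB, hΓ⟩
    · exact ihA (Multiset.forall_mem_cons.2 ⟨hA, hΓ⟩)
    · exact ihB (Multiset.forall_mem_cons.2 ⟨hB, hΓ⟩)
  | orR₁ _ ih => exact (Formula.holds_or v _ _).2 (.inl (ih hΓ))
  | orR₂ _ ih => exact (Formula.holds_or v _ _).2 (.inr (ih hΓ))
  | allL h t _ ih =>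
    rw [Multiset.forall_mem_cons, Formula.holds_all] at hΓ
    exact ih (Multiset.forall_mem_cons.2 ⟨hΓ.1 t, hΓ.2⟩)
  | allR h _ ih => exact (Formula.holds_all v h _).2 fun t => ih t hΓ
  | exL h _ ih =>
    rw [Multiset.forall_mem_cons, Formula.holds_ex] at hΓ
    obtain ⟨⟨t, ht⟩, hΓ⟩ := hΓ
    exact ih t (Multiset.forall_mem_cons.2 ⟨ht, hΓ⟩)
  | exR h t _ ih => exact (Formula.holds_ex v h _).2 ⟨t, ih hΓ⟩
  | nabL h k hk _ ih =>
    rw [Multiset.forall_mem_cons, Formula.holds_nab_iff_of_fresh hv h hk] at hΓ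
    exact ih (Multiset.forall_mem_cons.2 hΓ)
  | nabR h k hk _ ih => exact (Formula.holds_nab_iff_of_fresh hv h hk).2 (ih hΓ)
  | contrL _ ih => exact ih (Multiset.forall_mem_cons.2 ⟨hΓ _ (Multiset.mem_cons_self _ _), hΓ⟩)
  | weakL _ ih => exact ih (Multiset.forall_mem_cons.1 hΓ).2
  | ax A π _ =>
    rw [Tm.toGround_permute, Formula.holds_permute, hv]
    exact hΓ _ (Multiset.mem_singleton_self _)
  | mc Δ A _ _ ihΔ ih =>
    refine ih fun B hB => ?_
    rcases Multiset.mem_add.1 hB with hB | hB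
    · exact hΓ B (Multiset.mem_add.2 (.inl hB))
    · obtain ⟨i, -, rfl⟩ := Multiset.mem_map.1 hB
      refine ihΔ i fun B hB => hΓ B (Multiset.mem_add.2 (.inr ?_))
      exact Multiset.mem_sum.2 ⟨i, Finset.mem_univ i, hB⟩
  | defL hA _ ih =>
    rw [Multiset.forall_mem_cons] at hΓ
    obtain ⟨c, hc, B, hB, hholds⟩ := hdef _ hA hΓ.1
    exact ih c hc B hB (Multiset.forall_mem_cons.2 ⟨hholds, hΓ.2⟩)
  | defR c hc hB _ ih => exact hunfold _ ⟨_, .inl ⟨c, hc, hB⟩, ih hΓ⟩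
  | indL d hd T us _ _ ihT ih =>
    rw [Multiset.forall_mem_cons] at hΓ
    refine ih (Multiset.forall_mem_cons.2 ⟨hind d hd T (fun ts hts => ihT ts ?_) us hΓ.1, hΓ.2⟩)
    exact fun A hA => (Multiset.mem_singleton.1 hA) ▸ hts
  | indR d hd ts _ ih => exact hunfold _ ⟨_, .inr ⟨d, hd, ts, rfl, rfl⟩, ih hΓ⟩

end LD

-- Consistency

theorem mainTheorem3 {Base : Type u} [Finite Base] (S : LD.Signature Base)
    (D : Set (LD.Clause S)) (I : Set (LD.IndClause S)) (hvalid : LD.ValidDefs D I)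
    (lvl : LD.Formula S → Ordinal.{u}) (hD : LD.WeaklyStratified lvl D)
    (hI : LD.StrictlyStratified lvl I) :
    LD.Consistent D I := by
  have hl : ∀ A B, LD.Unfolds D I A B → LD.LevelLE (LD.minLevel lvl) B (LD.minLevel lvl A) :=
    fun A B h => h.levelLE hvalid hD hI
  intro h
  refine LD.Formula.holds_bot (LD.leastModel D I (LD.minLevel lvl))
    (h.sound (fun π => ?_) ?_ ?_ ?_ fun A hA => (Multiset.notMem_zero A hA).elim)
  · funext w p ts
    refine propext ⟨fun h' => ?_, LD.leastModel_permute hvalid (LD.minLevel_permute lvl) π⟩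
    have := LD.leastModel_permute hvalid (LD.minLevel_permute lvl) π⁻¹ h'
    rwa [LD.Spine.permute_inv_permute] at this
  · rintro A ⟨B, hB, hholds⟩
    obtain ⟨w, p, ts, rfl⟩ := hB.exists_atom hvalid
    exact (LD.Formula.holds_atom _ p ts).2 (LD.leastModel_of_unfolds hl hB hholds)
  · intro A hA hholds
    obtain ⟨w, p, ts, rfl, -⟩ := id hA
    obtain ⟨B, hB, hholds⟩ :=
      LD.exists_unfolds_of_leastModel hl ((LD.Formula.holds_atom _ p ts).1 hholds)
    obtain ⟨c, hc, hB⟩ := hB.of_nonInductiveAtom hA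
    exact ⟨c, hc, B, hB, hholds⟩
  · intro d hd T hT us hus
    refine LD.leastModel_ind hvalid hl hd (hI.minLevel_eq hd)
      (X := fun ts => LD.Formula.Holds _ (T.apps ts)) (fun ts hts => hT ts ?_)
      ((LD.Formula.holds_atom _ d.pred us).1 hus)
    -- The premise of `leastModel_ind` concerns the predicate revalued as the extension of `T`; this
    -- is exchanged for `T` itself, to which the premise of `μL` applies.
    exact ((hvalid.ind_valid d hd).holds_unfold _ T (fun _ => Iff.rfl) ts).1 hts
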